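/- Let $(X,Y)$ be a random pair in $\mathbb{R}^d\times\mathbb{R}$ with $\mathbb{E}\|X\|^2<\infty$ and $\mathbb{E}|Y|<\infty$ such that $\Sigma:=\mathbb{E}[XX^\top]$ is invertible, and let $\beta:=\Sigma^{-1}\mathbb{E}[XY]$. Let $(X_1,Y_1),\dots,(X_n,Y_n)$ be independent copies of $(X,Y)$, let $\hat\Sigma:=\frac1n\sum_{i=1}^n X_iX_i^\top$ and, when $\hat\Sigma$ is invertible, let $\hat\beta_{\mathrm{ols}}:=\hat\Sigma^{-1}\bigl(\frac1n\sum_{i=1}^n X_iY_i\bigr)$. Write $\|\cdot\|$ for the Euclidean norm of vectors and the spectral norm of matrices, and $\|x\|_\Sigma:=\sqrt{x^\top\Sigma x}$. Assume that the linear model is correct, $\mathbb{E}[Y\mid X]=X^\top\beta$ almost surely, and that the noise $\eta:=Y-\mathbb{E}[Y\mid X]$ is subgaussian: for some $\sigma\ge 0$ and every $\lambda\in\mathbb{R}$, almost surely $\mathbb{E}[e^{\lambda\eta}\mid X]\le e^{\lambda^2\sigma^2/2}$. Fix $\delta\in(0,1)$. (1) Suppose that for some $\rho_1\ge 1$ one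 has $\mathbb{E}\bigl[\exp(\alpha^\top\Sigma^{-1/2}X)\bigr]\le\exp(\rho_1\|\alpha\|^2/2)$ for all $\alpha\in\mathbb{R}^d$. Put $$n_{1,\delta}:=70\rho_1^2\bigl(d\log 41+\log(2/\delta)\bigr),\qquad K_{1,\delta,n}:=\frac{1}{1-\frac{10\rho_1}{9}\Bigl(\sqrt{\frac{32(d\log 41+\log(2/\delta))}{n}}+\frac{2(d\log 41+\log(2/\delta))}{n}\Bigr)}.$$ If $n>n_{1,\delta}$, then $K_{1,\delta,n}\le 5$ and, with probability at least $1-2\delta$, all of the following hold simultaneously: $\hat\Sigma$ is positive definite, $$\bigl\|\Sigma^{1/2}\hat\Sigma^{-1}\Sigma^{1/2}\bigr\|\le K_{1,\delta,n},\qquad\text{and}\qquad \|\hat\beta_{\mathrm{ols}}-\beta\|_\Sigma^2\le K_{1,\delta,n}\cdot\frac{\sigma^2\bigl(d+2\sqrt{d\log(1/\delta)}+2\log(1/\delta)\bigr)}{n}.$$ (2) Suppose that for some $\rho_2\ge 1$ one has $\|\Sigma^{-1/2}X\|/\sqrt d\le\rho_2$ almost surely. Put $$n_{2,\delta}:=4\rho_2^2\,d\log(d/\delta),\qquad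 K_{2,\delta,n}:=\frac{1}{1-\sqrt{\frac{2\rho_2^2\,d\log(d/\delta)}{n}}}.$$ If $n>n_{2,\delta}$, then $K_{2,\delta,n}\le 5$ and, with probability at least $1-2\delta$, all of the following hold simultaneously: $\hat\Sigma$ is positive definite, $$\bigl\|\Sigma^{1/2}\hat\Sigma^{-1}\Sigma^{1/2}\bigr\|\le K_{2,\delta,n},\qquad\text{and}\qquad \|\hat\beta_{\mathrm{ols}}-\beta\|_\Sigma^2\le K_{2,\delta,n}\cdot\frac{\sigma^2\bigl(d+2\sqrt{d\log(1/\delta)}+2\log(1/\delta)\bigr)}{n}.$$ -/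

import Mathlib

open MeasureTheory ProbabilityTheory
open scoped Matrix MatrixOrder

noncomputable section

namespace RandomDesign

/-- Covariate space `ℝ^d` with its Euclidean norm. -/
abbrev Vec (d : ℕ) : Type := EuclideanSpace ℝ (Fin d)

/-- Real `d × d` matrices. -/
abbrev Mat (d : ℕ) : Type := Matrix (Fin d) (Fin d) ℝ

/-- The matrix-vector product `A x`, as a vector of Euclidean space. -/
def app {d : ℕ} (A : Mat d) (x : Vec d) : Vec d :=
  Matrix.toEuclideanCLM (n := Fin d) (𝕜 := ℝ) A x

/-- The spectral norm of a matrix: the operator norm for the Euclidean vector norm. -/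
def specNorm {d : ℕ} (A : Mat d) : ℝ :=
  ‖Matrix.toEuclideanCLM (n := Fin d) (𝕜 := ℝ) A‖

/-- `‖x‖_M = √(xᵀ M x)`. -/
def mNorm {d : ℕ} (M : Mat d) (x : Vec d) : ℝ :=
  Real.sqrt (inner ℝ x (app M x))

/-- The positive semidefinite square root `M^{1/2}` of a positive semidefinite matrix. -/
def sqrtM {d : ℕ} (M : Mat d) : Mat d := CFC.sqrt M

section Population

variable {Ω : Type*} [MeasurableSpace Ω] {d : ℕ}

/-- The second moment matrix `Σ = E[X Xᵀ]`. -/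
def secondMoment (P : Measure Ω) (X : Ω → Vec d) : Mat d :=
  Matrix.of fun i j => ∫ ω, X ω i * X ω j ∂P

/-- `β = Σ⁻¹ E[X Y]`. -/
def betaStar (P : Measure Ω) (X : Ω → Vec d) (Y : Ω → ℝ) : Vec d :=
  app (secondMoment P X)⁻¹ (∫ ω, Y ω • X ω ∂P)

/-- The regression function `E[Y | X]`, as a random variable. -/
def regression (P : Measure Ω) (X : Ω → Vec d) (Y : Ω → ℝ) : Ω → ℝ :=
  P[Y | MeasurableSpace.comap X inferInstance]

/-- `noise(X) = Y - E[Y | X]`. -/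
def noise (P : Measure Ω) (X : Ω → Vec d) (Y : Ω → ℝ) : Ω → ℝ :=
  fun ω => Y ω - regression P X Y ω

/-- `bias(X) = E[Y | X] - Xᵀ β`. -/
def bias (P : Measure Ω) (X : Ω → Vec d) (Y : Ω → ℝ) : Ω → ℝ :=
  fun ω => regression P X Y ω - inner ℝ (X ω) (betaStar P X Y)

/-- The whitened covariate `Σ^{-1/2} X`. -/
def whitened (P : Measure Ω) (X : Ω → Vec d) : Ω → Vec d :=
  fun ω => app (sqrtM (secondMoment P X))⁻¹ (X ω)

/-- Subgaussian noise: for every `t`, almost surely `E[exp(t noise(X)) | X] ≤ exp(t² σ² / 2)`.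
Integrability of `exp(t noise(X))` (which the bound entails) is stated, because the conditional
expectation of a non-integrable function is `0` by convention. -/
def SubgaussianNoise (P : Measure Ω) (X : Ω → Vec d) (Y : Ω → ℝ) (σ : ℝ) : Prop :=
  0 ≤ σ ∧ ∀ t : ℝ,
    Integrable (fun ω => Real.exp (t * noise P X Y ω)) P ∧
    ∀ᵐ ω ∂P,
      (P[fun ω' => Real.exp (t * noise P X Y ω') | MeasurableSpace.comap X inferInstance]) ω
        ≤ Real.exp (t ^ 2 * σ ^ 2 / 2)

/-- Subgaussian projections: `E[exp(αᵀ Σ^{-1/2} X)] ≤ exp(ρ ‖α‖² / 2)` for every `α`. -/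
def SubgaussianProjections (P : Measure Ω) (X : Ω → Vec d) (ρ : ℝ) : Prop :=
  1 ≤ ρ ∧ ∀ α : Vec d,
    Integrable (fun ω => Real.exp (inner ℝ α (whitened P X ω))) P ∧
    ∫ ω, Real.exp (inner ℝ α (whitened P X ω)) ∂P ≤ Real.exp (ρ * ‖α‖ ^ 2 / 2)

/-- Bounded statistical leverage: `‖Σ^{-1/2} X‖ / √d ≤ ρ` almost surely. -/
def BoundedLeverage (P : Measure Ω) (X : Ω → Vec d) (ρ : ℝ) : Prop :=
  1 ≤ ρ ∧ ∀ᵐ ω ∂P, ‖whitened P X ω‖ / Real.sqrt d ≤ ρ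

end Population

section Sample

variable {d n : ℕ}

/-- The empirical second moment matrix `Σ̂ = (1/n) ∑ᵢ xᵢ xᵢᵀ`. -/
def empSecondMoment (x : Fin n → Vec d) : Mat d :=
  Matrix.of fun i j => (∑ k, x k i * x k j) / n

/-- The ordinary least squares estimator `Σ̂⁻¹ ((1/n) ∑ᵢ yᵢ xᵢ)`, for invertible `Σ̂`. -/
def ols (x : Fin n → Vec d) (y : Fin n → ℝ) : Vec d :=
  app (empSecondMoment x)⁻¹ ((n : ℝ)⁻¹ • ∑ k, y k • x k)

end Sample

/-- `n_{1,δ} = 70 ρ² (d log 41 + log(2/δ))`. -/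
def n₁ (d : ℕ) (ρ δ : ℝ) : ℝ :=
  70 * ρ ^ 2 * (d * Real.log 41 + Real.log (2 / δ))

/-- `n_{2,δ} = 4 ρ² d log(d/δ)`. -/
def n₂ (d : ℕ) (ρ δ : ℝ) : ℝ :=
  4 * ρ ^ 2 * d * Real.log (d / δ)

/-- `K_{1,δ,n}`. -/
def K₁ (d : ℕ) (ρ δ : ℝ) (n : ℕ) : ℝ :=
  1 / (1 - 10 * ρ / 9 *
    (Real.sqrt (32 * (d * Real.log 41 + Real.log (2 / δ)) / n)
      + 2 * (d * Real.log 41 + Real.log (2 / δ)) / n))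

/-- `K_{2,δ,n}`. -/
def K₂ (d : ℕ) (ρ δ : ℝ) (n : ℕ) : ℝ :=
  1 / (1 - Real.sqrt (2 * ρ ^ 2 * d * Real.log (d / δ) / n))

/-- The fixed design rate `σ² (d + 2 √(d log(1/δ)) + 2 log(1/δ)) / n`. -/
def rate (d : ℕ) (σ δ : ℝ) (n : ℕ) : ℝ :=
  σ ^ 2 * (d + 2 * Real.sqrt (d * Real.log (1 / δ)) + 2 * Real.log (1 / δ)) / n

end RandomDesign

end

/-! Put `W_i = Σ^{-1/2} X_i`, so that `E[W Wᵀ] = 1`. The result rests on two events, each failing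
with probability at most `δ`.

The design event is `∑ ⟪v, W_i⟫² ≥ n κ ‖v‖²` for all `v`, where `1 / κ` is the constant `K`. It says
`Σ̂ ≥ κ Σ`, which gives positive definiteness, the spectral norm bound, and `‖b‖_Σ² ≤ κ⁻¹ bᵀ Σ̂ b`
(`DesignLowerBound`). What remains is the in-sample error `bᵀ Σ̂ b` of `b = β̂ - β`, and the noise
event bounds it by the fixed design rate.

Design event, case (1): for a unit vector `u` the variable `⟪u, W⟫² - 1` is sub-gamma, so
Bernstein's inequality applies at each point of a `1/20`-net of the sphere. The net has at most
`41^d` points, and passing from the net to the sphere costs the factor `10/9`.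

Design event, case (2): this is a matrix Chernoff bound obtained by estimating `E tr exp(-θ ∑ W_i
W_iᵀ)`, integrating out one sample at a time. Rank one perturbations only need an elementary form of
Golden–Thompson (`trExp_sub_rankOne_le`): a differential inequality along `s ↦ A - s w wᵀ`, itself a
consequence of Chebyshev's sum inequality on the spectrum. Isotropy turns `E ⟪W, exp(A) W⟫` into `tr
exp A`, so each sample contributes a scalar factor.

Noise event: with `Q(h) = ∑ ⟪h, X_i⟫²`, the number `exp(s Q(b))` is the average of `exp(√(2s) ∑ ⟪h,
X_i⟫ η_i)` over `h` drawn from the Gaussian density proportional to `exp(-Q(h)/2)`. The exponent is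
linear in the noise, so conditional subgaussianity bounds its expectation by that of `exp(s σ²
Q(h))`, which averages to `(1 - 2sσ²)^{-d/2}`. Optimising over `s` gives `d + 2√(dt) + 2t` with `t =
log(1/δ)`. -/

noncomputable section

namespace RandomDesign

/-! ### Differentiating the operator exponential -/

open NormedSpace in
/-- The derivative of the exponential along a line in a (noncommutative) Banach algebra. -/
theorem hasDerivAt_exp_add_smul {𝔸 : Type*} [NormedRing 𝔸] [NormOneClass 𝔸] [NormedAlgebra ℝ 𝔸]
    [CompleteSpace 𝔸] (A H : 𝔸) (s : ℝ) :
    Summable (fun k : ℕ => (k.factorial : ℝ)⁻¹ •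
        ∑ i ∈ Finset.range k, (A + s • H) ^ (k.pred - i) * H * (A + s • H) ^ i) ∧
    HasDerivAt (fun r : ℝ => exp (A + r • H))
      (∑' k : ℕ, (k.factorial : ℝ)⁻¹ •
        ∑ i ∈ Finset.range k, (A + s • H) ^ (k.pred - i) * H * (A + s • H) ^ i) s := by
  -- `R` bounds `‖A + r • H‖` whenever `|r - s| < 1`, so `u` majorises the differentiated series on
  -- that ball; shifted by one index, `u` is the exponential series of `R` times `‖H‖`.
  set R : ℝ := ‖A‖ + (|s| + 1) * ‖H‖ with hR
  have hR0 : 0 ≤ R := by positivity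
  set u : ℕ → ℝ := fun k => (k.factorial : ℝ)⁻¹ * (k * R ^ k.pred * ‖H‖) with hu_def
  have hu : Summable u := by
    rw [← summable_nat_add_iff 1]
    have h := (Real.summable_pow_div_factorial R).mul_right ‖H‖
    refine h.congr fun k => ?_
    simp only [hu_def, Nat.pred_succ, Nat.factorial_succ]
    push_cast
    field_simp
  have hball : ∀ r ∈ Metric.ball s 1, ‖A + r • H‖ ≤ R := by
    intro r hr
    rw [Metric.mem_ball, Real.dist_eq] at hr
    have h1 : |r| ≤ |s| + 1 := by
      have := abs_sub_abs_le_abs_sub r s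
      linarith
    calc ‖A + r • H‖ ≤ ‖A‖ + ‖r • H‖ := norm_add_le _ _
      _ = ‖A‖ + |r| * ‖H‖ := by rw [norm_smul, Real.norm_eq_abs]
      _ ≤ R := by rw [hR]; gcongr
  have hbound : ∀ (k : ℕ) (r : ℝ), r ∈ Metric.ball s 1 →
      ‖(k.factorial : ℝ)⁻¹ • ∑ i ∈ Finset.range k,
        (A + r • H) ^ (k.pred - i) * H * (A + r • H) ^ i‖ ≤ u k := by
    intro k r hr
    have h1 := hball r hr
    rw [norm_smul, Real.norm_of_nonneg (by positivity)]
    simp only [hu_def]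
    gcongr
    refine (norm_sum_le _ _).trans ?_
    have : ∀ i ∈ Finset.range k, ‖(A + r • H) ^ (k.pred - i) * H * (A + r • H) ^ i‖
        ≤ R ^ k.pred * ‖H‖ := by
      intro i hi
      have hi' : i ≤ k.pred := Nat.le_pred_of_lt (Finset.mem_range.1 hi)
      calc ‖(A + r • H) ^ (k.pred - i) * H * (A + r • H) ^ i‖
          ≤ ‖A + r • H‖ ^ (k.pred - i) * ‖H‖ * ‖A + r • H‖ ^ i := by
            refine (norm_mul_le _ _).trans ?_
            gcongr
            · refine (norm_mul_le _ _).trans ?_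
              gcongr
              exact norm_pow_le _ _
            · exact norm_pow_le _ _
        _ ≤ R ^ (k.pred - i) * ‖H‖ * R ^ i := by gcongr
        _ = R ^ k.pred * ‖H‖ := by
            rw [mul_right_comm, ← pow_add, Nat.sub_add_cancel hi']
    refine (Finset.sum_le_sum this).trans ?_
    simp [mul_assoc]
  have hs : s ∈ Metric.ball s 1 := Metric.mem_ball_self one_pos
  refine ⟨Summable.of_norm_bounded hu fun k => hbound k s hs, ?_⟩
  have hexp : (fun r : ℝ => exp (A + r • H)) =
      fun r : ℝ => ∑' k : ℕ, (k.factorial : ℝ)⁻¹ • (A + r • H) ^ k := by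
    funext r
    rw [exp_eq_tsum ℝ]
  rw [hexp]
  refine hasDerivAt_tsum_of_isPreconnected (t := Metric.ball s 1) (y₀ := s)
    (g := fun (k : ℕ) (r : ℝ) => (k.factorial : ℝ)⁻¹ • (A + r • H) ^ k)
    (g' := fun (k : ℕ) (r : ℝ) => (k.factorial : ℝ)⁻¹ •
        ∑ i ∈ Finset.range k, (A + r • H) ^ (k.pred - i) * H * (A + r • H) ^ i) hu
    Metric.isOpen_ball (convex_ball s 1).isPreconnected ?_ hbound hs ?_ hs
  · intro k r _
    have h1 : HasDerivAt (fun r : ℝ => A + r • H) H r := by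
      simpa using ((hasDerivAt_id r).smul_const H).const_add A
    exact HasDerivAt.const_smul ((k.factorial : ℝ)⁻¹) (h1.fun_pow' k)
  · exact expSeries_summable' (𝕂 := ℝ) (A + s • H)

/-! ### Trace exponential of symmetric operators -/

section TraceExp

variable {E : Type*} [NormedAddCommGroup E] [InnerProductSpace ℝ E]

open NormedSpace InnerProductSpace

theorem inner_apply_eq_sum_of_eigen {ι : Type*} [Fintype ι] (b : OrthonormalBasis ι ℝ E)
    (S : E →L[ℝ] E) (c : ι → ℝ) (hS : ∀ l, S (b l) = c l • b l) (w : E) :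
    inner ℝ w (S w) = ∑ l, c l * inner ℝ (b l) w ^ 2 := by
  have h : S w = ∑ l, (c l * inner ℝ (b l) w) • b l := by
    conv_lhs => rw [← b.sum_repr' w]
    simp [map_sum, hS, smul_smul, mul_comm]
  rw [h, inner_sum]
  refine Finset.sum_congr rfl fun l _ => ?_
  rw [real_inner_smul_right, real_inner_comm]
  ring

theorem pow_apply_eigen {T : E →L[ℝ] E} {v : E} {r : ℝ} (h : T v = r • v) (k : ℕ) :
    (T ^ k) v = r ^ k • v := by
  induction k with
  | zero => simp
  | succ k ih =>
    rw [pow_succ, mul_apply_eq_comp, h, map_smul, ih, smul_smul, pow_succ, mul_comm]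

/-- The trace of the exponential. -/
def trExp (T : E →L[ℝ] E) : ℝ := LinearMap.trace ℝ E (exp T : E →L[ℝ] E)

theorem trExp_eq_sum {ι : Type*} [Fintype ι] (b : OrthonormalBasis ι ℝ E) (T : E →L[ℝ] E) :
    trExp T = ∑ l, inner ℝ (b l) ((exp T) (b l)) := by
  rw [trExp, LinearMap.trace_eq_sum_inner _ b]
  rfl

variable [FiniteDimensional ℝ E]

theorem exp_apply_eigen {T : E →L[ℝ] E} {v : E} {r : ℝ} (h : T v = r • v) :
    (exp T) v = Real.exp r • v := by
  have h1 : HasSum (fun k : ℕ => ((k.factorial : ℝ)⁻¹ • T ^ k) v) ((exp T) v) :=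
    (exp_series_hasSum_exp' (𝕂 := ℝ) T).mapL (ContinuousLinearMap.apply ℝ E v)
  have h2 : HasSum (fun k : ℕ => ((k.factorial : ℝ)⁻¹ • r ^ k) • v) (Real.exp r • v) := by
    rw [Real.exp_eq_exp_ℝ]
    exact (exp_series_hasSum_exp' (𝕂 := ℝ) r).smul_const v
  refine h1.unique (h2.congr_fun ?_)
  intro k
  simp [pow_apply_eigen h, smul_smul]

/-- Spectral decomposition, in the form used below. -/
theorem exists_eigenbasis {T : E →L[ℝ] E} (hT : T.IsSymmetric) :
    ∃ (b : OrthonormalBasis (Fin (Module.finrank ℝ E)) ℝ E) (c : Fin (Module.finrank ℝ E) → ℝ),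
      ∀ l, T (b l) = c l • b l :=
  ⟨LinearMap.IsSymmetric.eigenvectorBasis hT rfl, LinearMap.IsSymmetric.eigenvalues hT rfl,
    fun l => LinearMap.IsSymmetric.apply_eigenvectorBasis hT rfl l⟩

/-- `⟪w, Tⁱ w⟫ ⟪w, Tʲ w⟫ ≤ ‖w‖² ⟪w, Tⁱ⁺ʲ w⟫` for positive `T`. -/
theorem inner_pow_mul_inner_pow_le {T : E →L[ℝ] E} (hT : T.IsSymmetric)
    (hpos : ∀ x, 0 ≤ inner ℝ x (T x)) (w : E) (i j : ℕ) :
    inner ℝ w ((T ^ i) w) * inner ℝ w ((T ^ j) w) ≤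
      ‖w‖ ^ 2 * inner ℝ w ((T ^ (i + j)) w) := by
  obtain ⟨b, c, hc⟩ := exists_eigenbasis hT
  have hc0 : ∀ l, 0 ≤ c l := by
    intro l
    have := hpos (b l)
    rw [hc, real_inner_smul_right, real_inner_self_eq_norm_sq, b.norm_eq_one] at this
    simpa using this
  have hk : ∀ k, inner ℝ w ((T ^ k) w) = ∑ l, c l ^ k * inner ℝ (b l) w ^ 2 := fun k =>
    inner_apply_eq_sum_of_eigen b _ _ (fun l => pow_apply_eigen (hc l) k) w
  have h0 : ‖w‖ ^ 2 = ∑ l, inner ℝ (b l) w ^ 2 := by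
    have := hk 0
    simpa [real_inner_self_eq_norm_sq] using this
  rw [h0, hk, hk, hk, Finset.sum_mul_sum, Finset.sum_mul_sum]
  set a : Fin (Module.finrank ℝ E) → ℝ := fun l => inner ℝ (b l) w ^ 2
  have ha : ∀ l, 0 ≤ a l := fun l => sq_nonneg _
  -- Chebyshev's sum inequality by symmetrisation: powers of nonnegative eigenvalues are similarly
  -- ordered, so each term on the right is nonnegative.
  have hsym : ∑ l, ∑ m, a l * (c m ^ (i + j) * a m) - ∑ l, ∑ m, c l ^ i * a l * (c m ^ j * a m)
      = (1 / 2) * ∑ l, ∑ m, a l * a m * ((c l ^ i - c m ^ i) * (c l ^ j - c m ^ j)) := by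
    have e1 : ∑ l, ∑ m, a l * a m * ((c l ^ i - c m ^ i) * (c l ^ j - c m ^ j)) =
        (∑ l, ∑ m, a m * (c l ^ (i + j) * a l)) + (∑ l, ∑ m, a l * (c m ^ (i + j) * a m))
        - (∑ l, ∑ m, c l ^ i * a l * (c m ^ j * a m))
        - (∑ l, ∑ m, c m ^ i * a m * (c l ^ j * a l)) := by
      simp only [← Finset.sum_add_distrib, ← Finset.sum_sub_distrib]
      refine Finset.sum_congr rfl fun l _ => Finset.sum_congr rfl fun m _ => ?_
      rw [pow_add, pow_add]
      ring
    have e2 : (∑ l, ∑ m, a m * (c l ^ (i + j) * a l)) = ∑ l, ∑ m, a l * (c m ^ (i + j) * a m) :=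
      Finset.sum_comm
    have e3 : (∑ l, ∑ m, c m ^ i * a m * (c l ^ j * a l)) =
        ∑ l, ∑ m, c l ^ i * a l * (c m ^ j * a m) := Finset.sum_comm
    rw [e1, e2, e3]
    ring
  have hnn : 0 ≤ ∑ l, ∑ m, a l * a m * ((c l ^ i - c m ^ i) * (c l ^ j - c m ^ j)) := by
    refine Finset.sum_nonneg fun l _ => Finset.sum_nonneg fun m _ => ?_
    refine mul_nonneg (mul_nonneg (ha l) (ha m)) ?_
    rcases le_total (c l) (c m) with h | h
    · exact mul_nonneg_of_nonpos_of_nonpos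
        (sub_nonpos.2 (pow_le_pow_left₀ (hc0 l) h i)) (sub_nonpos.2 (pow_le_pow_left₀ (hc0 l) h j))
    · exact mul_nonneg
        (sub_nonneg.2 (pow_le_pow_left₀ (hc0 m) h i)) (sub_nonneg.2 (pow_le_pow_left₀ (hc0 m) h j))
  linarith

theorem continuous_trExp : Continuous (trExp : (E →L[ℝ] E) → ℝ) := by
  have h : (trExp : (E →L[ℝ] E) → ℝ) =
      fun T => ∑ l, inner ℝ (stdOrthonormalBasis ℝ E l) ((exp T) (stdOrthonormalBasis ℝ E l)) :=
    funext fun T => trExp_eq_sum _ T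
  rw [h]
  let _ : NormedAlgebra ℚ (E →L[ℝ] E) := NormedAlgebra.restrictScalars ℚ ℝ (E →L[ℝ] E)
  have := exp_continuous (𝔸 := E →L[ℝ] E)
  fun_prop

/-- Jensen's inequality for the spectral weights `⟪b l, v⟫²`, which sum to one; each weight is then
bounded by one. This converts a bad direction of a quadratic form into a large trace exponential. -/
theorem exp_inner_le_trExp {T : E →L[ℝ] E} (hT : T.IsSymmetric) {v : E} (hv : ‖v‖ = 1) :
    Real.exp (inner ℝ v (T v)) ≤ trExp T := by
  obtain ⟨b, c, hc⟩ := exists_eigenbasis hT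
  have h1 : trExp T = ∑ l, Real.exp (c l) := by
    rw [trExp_eq_sum b]
    refine Finset.sum_congr rfl fun l _ => ?_
    rw [exp_apply_eigen (hc l), real_inner_smul_right, real_inner_self_eq_norm_sq, b.norm_eq_one]
    simp
  have hsum : ∑ l, inner ℝ (b l) v ^ 2 = 1 := by
    have := inner_apply_eq_sum_of_eigen b (1 : E →L[ℝ] E) (fun _ => 1) (by simp) v
    simp only [one_apply_eq_self, real_inner_self_eq_norm_sq, hv, one_mul] at this
    simpa using this.symm
  rw [h1, inner_apply_eq_sum_of_eigen b T c hc]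
  calc Real.exp (∑ l, c l * inner ℝ (b l) v ^ 2)
      ≤ ∑ l, inner ℝ (b l) v ^ 2 * Real.exp (c l) := by
        have := convexOn_exp.map_sum_le (t := Finset.univ) (w := fun l => inner ℝ (b l) v ^ 2)
          (p := c) (fun l _ => sq_nonneg _) hsum (fun _ _ => Set.mem_univ _)
        simpa [mul_comm] using this
    _ ≤ ∑ l, Real.exp (c l) := by
        refine Finset.sum_le_sum fun l _ => ?_
        refine mul_le_of_le_one_left (Real.exp_pos _).le ?_
        rw [← hsum]
        exact Finset.single_le_sum (f := fun l => inner ℝ (b l) v ^ 2)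
          (fun l _ => sq_nonneg _) (Finset.mem_univ l)

theorem exp_add_smul_one (T : E →L[ℝ] E) (r : ℝ) :
    exp (T + r • (1 : E →L[ℝ] E)) = Real.exp r • exp T := by
  have h1 : exp (r • (1 : E →L[ℝ] E)) = Real.exp r • (1 : E →L[ℝ] E) := by
    ext v
    exact exp_apply_eigen (T := r • (1 : E →L[ℝ] E)) (v := v) (r := r) (by simp)
  let _ : NormedAlgebra ℚ (E →L[ℝ] E) := NormedAlgebra.restrictScalars ℚ ℝ (E →L[ℝ] E)
  rw [NormedSpace.exp_add_of_commute ((Commute.one_right T).smul_right r), h1]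
  simp

/-- Scalars commute with everything. This permits shifting an operator until it is positive. -/
theorem trExp_add_smul_one (T : E →L[ℝ] E) (r : ℝ) :
    trExp (T + r • (1 : E →L[ℝ] E)) = Real.exp r * trExp T := by
  rw [trExp, exp_add_smul_one, trExp]
  simp

theorem trExp_zero : trExp (0 : E →L[ℝ] E) = Module.finrank ℝ E := by
  simp [trExp, exp_zero]

theorem inner_exp_nonneg {T : E →L[ℝ] E} (hT : T.IsSymmetric) (v : E) :
    0 ≤ inner ℝ v ((exp T) v) := by
  obtain ⟨b, c, hc⟩ := exists_eigenbasis hT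
  rw [inner_apply_eq_sum_of_eigen b _ _ (fun l => exp_apply_eigen (hc l))]
  exact Finset.sum_nonneg fun l _ => by positivity

theorem trExp_nonneg {T : E →L[ℝ] E} (hT : T.IsSymmetric) : 0 ≤ trExp T := by
  rw [trExp_eq_sum (stdOrthonormalBasis ℝ E)]
  exact Finset.sum_nonneg fun l _ => inner_exp_nonneg hT _

end TraceExp

/-! ### Golden–Thompson inequality for rank one perturbations -/

section RankOneGoldenThompson

variable {E : Type*} [NormedAddCommGroup E] [InnerProductSpace ℝ E]

open NormedSpace InnerProductSpace

theorem isSymmetric_sub_smul_rankOne {A : E →L[ℝ] E} (hA : A.IsSymmetric) (w : E) (s : ℝ) :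
    (A - s • rankOne ℝ w w).IsSymmetric := by
  have h := isSymmetric_rankOne_self (𝕜 := ℝ) w
  intro x y
  have h1 := hA x y
  have h2 := h x y
  simp only [ContinuousLinearMap.coe_coe] at h1 h2
  simp only [ContinuousLinearMap.coe_coe, sub_apply, smul_apply, inner_sub_left,
    inner_sub_right, inner_smul_left, inner_smul_right, h1, h2, conj_trivial]

variable [FiniteDimensional ℝ E]

/-- The derivative of `ℓ (exp (A - s w wᵀ))` for a linear functional `ℓ`, as a series. -/
theorem hasDerivAt_functional_exp [Nontrivial E] (ℓ : (E →L[ℝ] E) →ₗ[ℝ] ℝ) (A : E →L[ℝ] E) (w : E)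
    (s : ℝ) (a : ℕ → ℝ)
    (ha : ∀ k, a k = ∑ i ∈ Finset.range k, ℓ ((A - s • rankOne ℝ w w) ^ (k.pred - i) *
      rankOne ℝ w w * (A - s • rankOne ℝ w w) ^ i)) :
    ∃ D, HasSum (fun k : ℕ => (k.factorial : ℝ)⁻¹ * a k) D ∧
      HasDerivAt (fun r : ℝ => ℓ (exp (A - r • rankOne ℝ w w))) (-D) s := by
  set H := rankOne ℝ w w with hH
  obtain ⟨hs, hd⟩ := hasDerivAt_exp_add_smul A (-H) s
  have hsub : ∀ r : ℝ, A + r • (-H) = A - r • H := fun r => by rw [smul_neg, sub_eq_add_neg]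
  simp only [hsub] at hs hd
  let ℓc : (E →L[ℝ] E) →L[ℝ] ℝ := LinearMap.toContinuousLinearMap ℓ
  have hℓ : ∀ T, ℓc T = ℓ T := fun T => rfl
  have h1 := hs.hasSum.mapL ℓc
  have h2 := ℓc.hasFDerivAt.comp_hasDerivAt s hd
  refine ⟨-ℓc (∑' k : ℕ, (k.factorial : ℝ)⁻¹ •
        ∑ i ∈ Finset.range k, (A - s • H) ^ (k.pred - i) * -H * (A - s • H) ^ i), ?_, ?_⟩
  · refine h1.neg.congr_fun fun k => ?_
    rw [ha, hℓ, map_smul, map_sum, smul_eq_mul, ← mul_neg, ← Finset.sum_neg_distrib]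
    congr 1
    refine Finset.sum_congr rfl fun i _ => ?_
    rw [mul_neg, neg_mul, map_neg, neg_neg]
  · rw [neg_neg]
    exact h2

theorem hasSum_inner_exp (T : E →L[ℝ] E) (v : E) :
    HasSum (fun k : ℕ => (k.factorial : ℝ)⁻¹ * inner ℝ v ((T ^ k) v)) (inner ℝ v ((exp T) v)) := by
  have h := ((exp_series_hasSum_exp' (𝕂 := ℝ) T).mapL (ContinuousLinearMap.apply ℝ E v)).mapL
    (innerSL ℝ v)
  refine h.congr_fun fun k => ?_
  simp

/-- Cyclicity of the trace makes the `k` summands of order `k` equal, and `k / k! = 1 / (k-1)!`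
restores the exponential series. -/
theorem hasDerivAt_trExp_sub_rankOne [Nontrivial E] (A : E →L[ℝ] E) (w : E) (s : ℝ) :
    HasDerivAt (fun r : ℝ => trExp (A - r • rankOne ℝ w w))
      (-inner ℝ w ((exp (A - s • rankOne ℝ w w)) w)) s := by
  set T := A - s • rankOne ℝ w w with hT
  let ℓ : (E →L[ℝ] E) →ₗ[ℝ] ℝ := LinearMap.trace ℝ E ∘ₗ ContinuousLinearMap.coeLM ℝ
  have hℓ : ∀ S, ℓ S = LinearMap.trace ℝ E (S : E →ₗ[ℝ] E) := fun S => rfl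
  have hmul : ∀ S S' : E →L[ℝ] E, ℓ (S * S') = ℓ (S' * S) := fun S S' => by
    simp only [hℓ]
    exact LinearMap.trace_mul_comm ℝ _ _
  have htr : ∀ S : E →L[ℝ] E, ℓ (S * rankOne ℝ w w) = inner ℝ w (S w) := by
    intro S
    have : S * rankOne ℝ w w = rankOne ℝ (S w) w := by
      ext x; simp
    rw [this, hℓ, trace_rankOne]
  obtain ⟨D, hD, hder⟩ := hasDerivAt_functional_exp ℓ A w s
    (fun k => k * inner ℝ w ((T ^ k.pred) w)) (by
      intro k
      rw [Finset.sum_congr rfl (g := fun _ => inner ℝ w ((T ^ k.pred) w))]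
      · simp
      · intro i hi
        rw [hmul, ← mul_assoc, ← pow_add, htr,
          Nat.add_sub_cancel' (Nat.le_pred_of_lt (Finset.mem_range.1 hi))])
  have hD' : D = inner ℝ w ((exp T) w) := by
    -- The term `k = 0` vanishes, so the series may start at `k = 1`, where `k.pred` is a true
    -- predecessor.
    rw [← hasSum_nat_add_iff' 1] at hD
    simp only [Finset.range_one, Finset.sum_singleton, Nat.cast_zero, zero_mul, mul_zero,
      sub_zero] at hD
    refine hD.unique ((hasSum_inner_exp T w).congr_fun fun k => ?_)
    rw [Nat.pred_succ, Nat.factorial_succ]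
    push_cast
    field_simp
  rw [← hD']
  exact hder

/-- Inserting `w wᵀ` between two powers of `T` produces `⟪w, Tⁱ w⟫ ⟪w, Tʲ w⟫`;
`inner_pow_mul_inner_pow_le` merges the two factors, and this is where positivity is used. -/
theorem exists_hasDerivAt_inner_exp_sub_rankOne [Nontrivial E] (A : E →L[ℝ] E) (w : E) (s : ℝ)
    (hsym : (A - s • rankOne ℝ w w).IsSymmetric)
    (hpos : ∀ x, 0 ≤ inner ℝ x ((A - s • rankOne ℝ w w) x)) :
    ∃ D, HasDerivAt (fun r : ℝ => inner ℝ w ((exp (A - r • rankOne ℝ w w)) w)) D s ∧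
      -(‖w‖ ^ 2 * inner ℝ w ((exp (A - s • rankOne ℝ w w)) w)) ≤ D := by
  set T := A - s • rankOne ℝ w w with hT
  let ℓ : (E →L[ℝ] E) →ₗ[ℝ] ℝ :=
    ((innerSL ℝ w).comp (ContinuousLinearMap.apply ℝ E w)).toLinearMap
  have hℓ : ∀ S, ℓ S = inner ℝ w (S w) := fun S => rfl
  obtain ⟨D, hD, hder⟩ := hasDerivAt_functional_exp ℓ A w s
    (fun k => ∑ i ∈ Finset.range k, inner ℝ w ((T ^ (k.pred - i)) w) * inner ℝ w ((T ^ i) w)) (by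
      intro k
      refine Finset.sum_congr rfl fun i _ => ?_
      simp [hℓ, ← hT, inner_smul_right, mul_comm])
  refine ⟨-D, hder, neg_le_neg ?_⟩
  have hR : HasSum (fun k : ℕ => (k.factorial : ℝ)⁻¹ * (k * (‖w‖ ^ 2 * inner ℝ w ((T ^ k.pred) w))))
      (‖w‖ ^ 2 * inner ℝ w ((exp T) w)) := by
    rw [← hasSum_nat_add_iff' 1]
    simp only [Finset.range_one, Finset.sum_singleton, Nat.cast_zero, zero_mul, mul_zero,
      sub_zero]
    refine ((hasSum_inner_exp T w).mul_left (‖w‖ ^ 2)).congr_fun fun k => ?_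
    rw [Nat.pred_succ, Nat.factorial_succ]
    push_cast
    field_simp
  refine hasSum_le (fun k => ?_) hD hR
  gcongr
  calc ∑ i ∈ Finset.range k, inner ℝ w ((T ^ (k.pred - i)) w) * inner ℝ w ((T ^ i) w)
      ≤ ∑ i ∈ Finset.range k, ‖w‖ ^ 2 * inner ℝ w ((T ^ k.pred) w) := by
        refine Finset.sum_le_sum fun i hi => ?_
        have := inner_pow_mul_inner_pow_le hsym hpos w (k.pred - i) i
        rwa [Nat.sub_add_cancel (Nat.le_pred_of_lt (Finset.mem_range.1 hi))] at this
    _ = k * (‖w‖ ^ 2 * inner ℝ w ((T ^ k.pred) w)) := by simp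

/-- A Gronwall argument. For `f s = ⟪w, exp(A - s w wᵀ) w⟫` one has `f' ≥ -B f`, hence `f s ≥ f 0 ·
exp(-s B)`. Since the trace exponential has derivative `-f`, integrating over `[0, θ]` gives the
bound. -/
theorem trExp_sub_rankOne_le_of_nonneg [Nontrivial E] {A : E →L[ℝ] E} (hA : A.IsSymmetric) {w : E}
    {θ B : ℝ} (hθ : 0 ≤ θ) (hB : 0 < B) (hw : ‖w‖ ^ 2 ≤ B)
    (hpos : ∀ x, 0 ≤ inner ℝ x ((A - θ • rankOne ℝ w w) x)) :
    trExp (A - θ • rankOne ℝ w w) ≤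
      trExp A - (1 - Real.exp (-(θ * B))) / B * inner ℝ w ((exp A) w) := by
  -- Positivity at the endpoint `θ` passes to all smaller `s`, where less of a positive operator is
  -- subtracted.
  have hsym := isSymmetric_sub_smul_rankOne hA w
  have hpos' : ∀ s ∈ Set.Icc 0 θ, ∀ x, 0 ≤ inner ℝ x ((A - s • rankOne ℝ w w) x) := by
    intro s hs x
    have h1 := hpos x
    simp only [sub_apply, smul_apply, inner_sub_right, inner_smul_right, rankOne_apply] at h1 ⊢
    have h2 : 0 ≤ (θ - s) * (inner ℝ w x * inner ℝ x w) := by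
      rw [real_inner_comm x w]
      exact mul_nonneg (sub_nonneg.2 hs.2) (mul_self_nonneg _)
    nlinarith
  set f : ℝ → ℝ := fun r => inner ℝ w ((exp (A - r • rankOne ℝ w w)) w) with hf
  have hf0 : ∀ s, 0 ≤ f s := fun s => inner_exp_nonneg (hsym s) w
  have hder : ∀ s : ℝ, ∃ D, s ∈ Set.Icc 0 θ → HasDerivAt f D s ∧ -(B * f s) ≤ D := by
    intro s
    by_cases hs : s ∈ Set.Icc 0 θ
    · obtain ⟨D, h1, h2⟩ := exists_hasDerivAt_inner_exp_sub_rankOne A w s (hsym s) (hpos' s hs)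
      refine ⟨D, fun _ => ⟨h1, le_trans ?_ h2⟩⟩
      exact neg_le_neg (mul_le_mul_of_nonneg_right hw (hf0 s))
    · exact ⟨0, fun h => absurd h hs⟩
  choose f' hf' using hder
  have hsub_int : interior (Set.Icc 0 θ) ⊆ Set.Icc 0 θ := interior_subset
  have hmono : MonotoneOn (fun s => Real.exp (s * B) * f s) (Set.Icc 0 θ) := by
    have hd : ∀ s ∈ Set.Icc 0 θ, HasDerivAt (fun s => Real.exp (s * B) * f s)
        (Real.exp (s * B) * B * f s + Real.exp (s * B) * f' s) s := by
      intro s hs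
      have h1 : HasDerivAt (fun s : ℝ => Real.exp (s * B)) (Real.exp (s * B) * B) s := by
        simpa using ((hasDerivAt_id s).mul_const B).exp
      exact h1.mul (hf' s hs).1
    refine monotoneOn_of_hasDerivWithinAt_nonneg (convex_Icc 0 θ)
      (fun s hs => (hd s hs).continuousAt.continuousWithinAt)
      (fun s hs => (hd s (hsub_int hs)).hasDerivWithinAt) ?_
    intro s hs
    have h1 := (hf' s (hsub_int hs)).2
    have h2 := Real.exp_pos (s * B)
    nlinarith
  have hanti : AntitoneOn (fun s => trExp (A - s • rankOne ℝ w w) +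
      f 0 * ((1 - Real.exp (-(s * B))) / B)) (Set.Icc 0 θ) := by
    have hd : ∀ s ∈ Set.Icc 0 θ, HasDerivAt (fun s => trExp (A - s • rankOne ℝ w w) +
        f 0 * ((1 - Real.exp (-(s * B))) / B)) (-f s + f 0 * Real.exp (-(s * B))) s := by
      intro s hs
      have h1 : HasDerivAt (fun s : ℝ => (1 - Real.exp (-(s * B))) / B)
          (Real.exp (-(s * B))) s := by
        have h2 := (((hasDerivAt_id s).mul_const B).neg.exp.const_sub 1).div_const B
        convert! h2 using 1
        simp only [id, Pi.neg_apply]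
        field_simp
      exact (hasDerivAt_trExp_sub_rankOne A w s).add (h1.const_mul _)
    refine antitoneOn_of_hasDerivWithinAt_nonpos (convex_Icc 0 θ)
      (fun s hs => (hd s hs).continuousAt.continuousWithinAt)
      (fun s hs => (hd s (hsub_int hs)).hasDerivWithinAt) ?_
    intro s hs
    have h1 := hmono (Set.left_mem_Icc.2 hθ) (hsub_int hs) (hsub_int hs).1
    simp only [zero_mul, Real.exp_zero, one_mul] at h1
    have h2 : f 0 * Real.exp (-(s * B)) ≤ f s := by
      rw [Real.exp_neg, ← div_eq_mul_inv, div_le_iff₀ (Real.exp_pos _), mul_comm]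
      exact h1
    linarith
  have := hanti (Set.left_mem_Icc.2 hθ) (Set.right_mem_Icc.2 hθ) hθ
  simp only [hf, zero_smul, sub_zero, zero_mul, neg_zero, Real.exp_zero, sub_self, zero_div,
    mul_zero, add_zero] at this
  linarith

/-- The Golden–Thompson inequality for a rank one perturbation:
`tr exp (A - θ w wᵀ) ≤ tr (exp A · exp (-θ w wᵀ))`, with the second factor bounded above using
`‖w‖² ≤ B`. -/
theorem trExp_sub_rankOne_le [Nontrivial E] {A : E →L[ℝ] E} (hA : A.IsSymmetric) {w : E}
    {θ B : ℝ} (hθ : 0 ≤ θ) (hB : 0 < B) (hw : ‖w‖ ^ 2 ≤ B) :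
    trExp (A - θ • rankOne ℝ w w) ≤
      trExp A - (1 - Real.exp (-(θ * B))) / B * inner ℝ w ((exp A) w) := by
  -- Adding `c • 1` makes the perturbed operator positive and multiplies both sides by `exp c`,
  -- which cancels at the end.
  set c : ℝ := ‖A - θ • rankOne ℝ w w‖ with hc
  have hA' : (A + c • (1 : E →L[ℝ] E)).IsSymmetric := by
    intro x y
    have h1 := hA x y
    simp only [ContinuousLinearMap.coe_coe] at h1
    simp [inner_add_left, inner_add_right, inner_smul_left, inner_smul_right, h1]
  have h := trExp_sub_rankOne_le_of_nonneg hA' hθ hB hw (by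
    intro x
    have h1 : inner ℝ x ((A + c • (1 : E →L[ℝ] E) - θ • rankOne ℝ w w) x) =
        inner ℝ x ((A - θ • rankOne ℝ w w) x) + c * ‖x‖ ^ 2 := by
      rw [← real_inner_self_eq_norm_sq, ← inner_smul_right, ← inner_add_right]
      congr 1
      simp only [sub_apply, add_apply, smul_apply, one_apply_eq_self]
      abel
    have h2 := abs_real_inner_le_norm x ((A - θ • rankOne ℝ w w) x)
    have h3 : ‖x‖ * ‖(A - θ • rankOne ℝ w w) x‖ ≤ c * ‖x‖ ^ 2 := by
      have := (A - θ • rankOne ℝ w w).le_opNorm x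
      nlinarith [norm_nonneg x]
    rw [h1]
    linarith [neg_abs_le (inner ℝ x ((A - θ • rankOne ℝ w w) x))])
  have e : A + c • (1 : E →L[ℝ] E) - θ • rankOne ℝ w w =
      (A - θ • rankOne ℝ w w) + c • (1 : E →L[ℝ] E) := by abel
  rw [e, trExp_add_smul_one, trExp_add_smul_one, exp_add_smul_one, smul_apply,
    inner_smul_right] at h
  have hexp := Real.exp_pos c
  refine le_of_mul_le_mul_left (h.trans_eq ?_) hexp
  ring

end RankOneGoldenThompson

/-! ### Matrix Chernoff bound for bounded isotropic vectors -/

/-- Tonelli's theorem for the first coordinate of a finite product of equal factors. -/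
theorem lintegral_pi_succ {α : Type*} [MeasurableSpace α] (ν : Measure α) [SigmaFinite ν] {n : ℕ}
    {f : (Fin (n + 1) → α) → ENNReal} (hf : Measurable f) :
    ∫⁻ z, f z ∂Measure.pi (fun _ => ν) =
      ∫⁻ x, ∫⁻ y, f (Fin.cons x y) ∂Measure.pi (fun _ : Fin n => ν) ∂ν := by
  have h := (measurePreserving_piFinSuccAbove (fun _ : Fin (n + 1) => ν) 0).symm
  have hm := hf.comp h.measurable
  simp only [Function.comp_def] at hm
  rw [← h.lintegral_comp hf]
  refine (lintegral_prod (μ := ν) (ν := Measure.pi (fun _ : Fin n => ν)) _ hm.aemeasurable).trans ?_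
  simp [MeasurableEquiv.piFinSuccAbove, Fin.insertNthEquiv]

theorem measurable_fin_cons {α : Type*} [MeasurableSpace α] {n : ℕ} :
    Measurable (fun p : α × (Fin n → α) => (Fin.cons p.1 p.2 : Fin (n + 1) → α)) := by
  refine measurable_pi_iff.2 fun i => ?_
  refine Fin.cases ?_ (fun j => ?_) i
  · simpa using measurable_fst
  · simpa [Function.comp_def] using (measurable_pi_apply j).comp measurable_snd

section MatrixChernoff

variable {E : Type*} [NormedAddCommGroup E] [InnerProductSpace ℝ E]

open NormedSpace InnerProductSpace

theorem continuous_rankOne_self : Continuous (fun w : E => rankOne ℝ w w) := by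
  have : (fun w : E => rankOne ℝ w w) = fun w : E => (innerSL ℝ w).smulRight w := rfl
  rw [this]
  fun_prop

variable [FiniteDimensional ℝ E] [MeasurableSpace E]

/-- For an isotropic random vector, `E ⟪w, exp(A) w⟫ = tr exp(A)`. -/
theorem integral_inner_exp_eq_trExp {ν : Measure E}
    (hsqInt : ∀ v : E, Integrable (fun w => inner ℝ v w ^ 2) ν)
    (hiso : ∀ v : E, ∫ w, inner ℝ v w ^ 2 ∂ν = ‖v‖ ^ 2) {A : E →L[ℝ] E} (hA : A.IsSymmetric) :
    Integrable (fun w => inner ℝ w ((exp A) w)) ν ∧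
      ∫ w, inner ℝ w ((exp A) w) ∂ν = trExp A := by
  obtain ⟨b, c, hc⟩ := exists_eigenbasis hA
  have h1 : (fun w => inner ℝ w ((exp A) w)) =
      fun w => ∑ l, Real.exp (c l) * inner ℝ (b l) w ^ 2 :=
    funext fun w => inner_apply_eq_sum_of_eigen b _ _ (fun l => exp_apply_eigen (hc l)) w
  rw [h1]
  refine ⟨integrable_finsetSum _ fun l _ => (hsqInt (b l)).const_mul _, ?_⟩
  rw [integral_finsetSum _ fun l _ => (hsqInt (b l)).const_mul _, trExp_eq_sum b]
  refine Finset.sum_congr rfl fun l _ => ?_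
  rw [integral_const_mul, hiso, exp_apply_eigen (hc l), real_inner_smul_right,
    real_inner_self_eq_norm_sq]

/-- By isotropy the rank one bound integrates to `(1 - c) tr exp A` with `c = (1 - exp(-θB)) / B`,
and `1 - c ≤ exp(-c)`. -/
theorem lintegral_trExp_sub_rankOne_le [Nontrivial E] {ν : Measure E} [IsProbabilityMeasure ν]
    (hsqInt : ∀ v : E, Integrable (fun w => inner ℝ v w ^ 2) ν)
    (hiso : ∀ v : E, ∫ w, inner ℝ v w ^ 2 ∂ν = ‖v‖ ^ 2)
    {θ B : ℝ} (hθ : 0 ≤ θ) (hB : 0 < B) (hbd : ∀ᵐ w ∂ν, ‖w‖ ^ 2 ≤ B)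
    {A : E →L[ℝ] E} (hA : A.IsSymmetric) :
    ∫⁻ w, ENNReal.ofReal (trExp (A - θ • rankOne ℝ w w)) ∂ν ≤
      ENNReal.ofReal (Real.exp (-((1 - Real.exp (-(θ * B))) / B)) * trExp A) := by
  set c := (1 - Real.exp (-(θ * B))) / B
  obtain ⟨h1, h2⟩ := integral_inner_exp_eq_trExp hsqInt hiso hA
  have hle : ∀ᵐ w ∂ν, trExp (A - θ • rankOne ℝ w w) ≤ trExp A - c * inner ℝ w ((exp A) w) := by
    filter_upwards [hbd] with w hw using trExp_sub_rankOne_le hA hθ hB hw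
  have hnn : ∀ᵐ w ∂ν, 0 ≤ trExp A - c * inner ℝ w ((exp A) w) := by
    filter_upwards [hle] with w hw
    exact (trExp_nonneg (isSymmetric_sub_smul_rankOne hA w θ)).trans hw
  have hI : Integrable (fun w => trExp A - c * inner ℝ w ((exp A) w)) ν :=
    (integrable_const _).sub (h1.const_mul _)
  calc ∫⁻ w, ENNReal.ofReal (trExp (A - θ • rankOne ℝ w w)) ∂ν
      ≤ ∫⁻ w, ENNReal.ofReal (trExp A - c * inner ℝ w ((exp A) w)) ∂ν :=
        lintegral_mono_ae (hle.mono fun w hw => ENNReal.ofReal_le_ofReal hw)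
    _ = ENNReal.ofReal (∫ w, (trExp A - c * inner ℝ w ((exp A) w)) ∂ν) :=
        (ofReal_integral_eq_lintegral_ofReal hI hnn).symm
    _ ≤ ENNReal.ofReal (Real.exp (-c) * trExp A) := by
        apply ENNReal.ofReal_le_ofReal
        rw [integral_sub (integrable_const _) (h1.const_mul _), integral_const_mul, h2]
        simp only [integral_const, probReal_univ, one_smul]
        have := Real.add_one_le_exp (-c)
        nlinarith [trExp_nonneg hA]

variable [BorelSpace E]

/-- Induction on the sample size with `A` arbitrary: once the first sample `x` is fixed, the others
see the matrix `A - θ x xᵀ`. -/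
theorem lintegral_pi_trExp_le [Nontrivial E] {ν : Measure E} [IsProbabilityMeasure ν]
    (hsqInt : ∀ v : E, Integrable (fun w => inner ℝ v w ^ 2) ν)
    (hiso : ∀ v : E, ∫ w, inner ℝ v w ^ 2 ∂ν = ‖v‖ ^ 2)
    {θ B : ℝ} (hθ : 0 ≤ θ) (hB : 0 < B) (hbd : ∀ᵐ w ∂ν, ‖w‖ ^ 2 ≤ B) (n : ℕ) :
    ∀ {A : E →L[ℝ] E}, A.IsSymmetric →
    ∫⁻ w, ENNReal.ofReal (trExp (A - θ • ∑ i, rankOne ℝ (w i) (w i)))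
        ∂Measure.pi (fun _ : Fin n => ν) ≤
      ENNReal.ofReal (Real.exp (-((1 - Real.exp (-(θ * B))) / B)) ^ n * trExp A) := by
  set c := (1 - Real.exp (-(θ * B))) / B
  have hmeas : ∀ (k : ℕ) (A : E →L[ℝ] E), Measurable (fun w : Fin k → E =>
      ENNReal.ofReal (trExp (A - θ • ∑ i, rankOne ℝ (w i) (w i)))) := by
    intro k A
    apply ENNReal.measurable_ofReal.comp
    apply Continuous.measurable
    have h1 := continuous_trExp (E := E)
    have h2 := continuous_rankOne_self (E := E)
    refine h1.comp (continuous_const.sub (Continuous.const_smul ?_ θ))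
    exact continuous_finsetSum _ fun i _ => h2.comp (continuous_apply i)
  induction n with
  | zero =>
    intro A hA
    simp
  | succ n ih =>
    intro A hA
    rw [lintegral_pi_succ ν (hmeas _ A)]
    calc ∫⁻ x, ∫⁻ y, ENNReal.ofReal (trExp (A - θ • ∑ i, rankOne ℝ
            ((Fin.cons x y : Fin (n + 1) → E) i) ((Fin.cons x y : Fin (n + 1) → E) i)))
            ∂Measure.pi (fun _ : Fin n => ν) ∂ν
        ≤ ∫⁻ x, ENNReal.ofReal (Real.exp (-c) ^ n) *
            ENNReal.ofReal (trExp (A - θ • rankOne ℝ x x)) ∂ν := by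
          refine lintegral_mono fun x => ?_
          rw [← ENNReal.ofReal_mul (by positivity)]
          refine le_trans (le_of_eq ?_) (ih (isSymmetric_sub_smul_rankOne hA x θ))
          refine lintegral_congr fun y => ?_
          rw [Fin.sum_univ_succ]
          simp only [Fin.cons_zero, Fin.cons_succ, smul_add, sub_sub]
      _ = ENNReal.ofReal (Real.exp (-c) ^ n) *
            ∫⁻ x, ENNReal.ofReal (trExp (A - θ • rankOne ℝ x x)) ∂ν := by
          rw [lintegral_const_mul' _ _ ENNReal.ofReal_ne_top]
      _ ≤ ENNReal.ofReal (Real.exp (-c) ^ n) * ENNReal.ofReal (Real.exp (-c) * trExp A) := by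
          gcongr
          exact lintegral_trExp_sub_rankOne_le hsqInt hiso hθ hB hbd hA
      _ = ENNReal.ofReal (Real.exp (-c) ^ (n + 1) * trExp A) := by
          rw [← ENNReal.ofReal_mul (by positivity)]
          ring_nf

/-- From `exp x ≥ 1 + x + x²/2` and `(1 + x + x²/2)(1 - x + x²/2) = 1 + x⁴/4 ≥ 1`. -/
theorem one_sub_exp_neg_ge {x : ℝ} (hx : 0 ≤ x) : x - x ^ 2 / 2 ≤ 1 - Real.exp (-x) := by
  have h1 : Real.exp (-x) * Real.exp x = 1 := by rw [← Real.exp_add]; simp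
  have h2 := Real.quadratic_le_exp_of_nonneg hx
  have h3 := Real.exp_pos (-x)
  nlinarith [sq_nonneg x, sq_nonneg (x^2), mul_nonneg h3.le (sub_nonneg.2 h2)]

/-- Lower tail of the smallest eigenvalue of a sum of independent isotropic rank one matrices. -/
theorem measure_pi_exists_sum_sq_lt_le [Nontrivial E] {ν : Measure E} [IsProbabilityMeasure ν]
    (hsqInt : ∀ v : E, Integrable (fun w => inner ℝ v w ^ 2) ν)
    (hiso : ∀ v : E, ∫ w, inner ℝ v w ^ 2 ∂ν = ‖v‖ ^ 2)
    {B t : ℝ} (hB : 0 < B) (ht : 0 ≤ t) (hbd : ∀ᵐ w ∂ν, ‖w‖ ^ 2 ≤ B) (n : ℕ) :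
    Measure.pi (fun _ : Fin n => ν)
        {w | ∃ v : E, ∑ i, inner ℝ v (w i) ^ 2 < n * (1 - t) * ‖v‖ ^ 2} ≤
      ENNReal.ofReal (Module.finrank ℝ E * Real.exp (-(n * t ^ 2 / (2 * B)))) := by
  -- With `θB = t`, the exponent `-nc + θn(1 - t)` is at most `(n/B)(-(t - t²/2) + t - t²) =
  -- -nt²/(2B)`.
  set θ : ℝ := t / B with hθ_def
  have hθ : 0 ≤ θ := by positivity
  set c := (1 - Real.exp (-(θ * B))) / B with hc
  have hsym0 : (0 : E →L[ℝ] E).IsSymmetric := fun x y => by simp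
  have hexp := lintegral_pi_trExp_le hsqInt hiso hθ hB hbd n hsym0
  rw [trExp_zero] at hexp
  set Φ : (Fin n → E) → ENNReal := fun w =>
    ENNReal.ofReal (trExp (0 - θ • ∑ i, rankOne ℝ (w i) (w i))) with hΦ
  set a : ℝ := Real.exp (-(θ * (n * (1 - t)))) with ha
  have hsub : {w : Fin n → E | ∃ v : E, ∑ i, inner ℝ v (w i) ^ 2 < n * (1 - t) * ‖v‖ ^ 2} ⊆
      {w | ENNReal.ofReal a ≤ Φ w} := by
    rintro w ⟨v, hv⟩
    have hv0 : v ≠ 0 := by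
      rintro rfl
      simp at hv
    have hnv : 0 < ‖v‖ := norm_pos_iff.2 hv0
    refine ENNReal.ofReal_le_ofReal ?_
    have hsym : (0 - θ • ∑ i, rankOne ℝ (w i) (w i) : E →L[ℝ] E).IsSymmetric := by
      intro x y
      simp only [zero_sub, ContinuousLinearMap.coe_coe, neg_apply, smul_apply, sum_apply,
        rankOne_apply, inner_neg_left, inner_neg_right, inner_smul_left, inner_smul_right,
        sum_inner, inner_sum, conj_trivial]
      congr 2
      refine Finset.sum_congr rfl fun i _ => ?_
      rw [real_inner_comm x (w i), mul_comm]
    have hu : ‖‖v‖⁻¹ • v‖ = 1 := by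
      rw [norm_smul, norm_inv, norm_norm, inv_mul_cancel₀ hnv.ne']
    refine le_trans ?_ (exp_inner_le_trExp hsym hu)
    rw [ha]
    apply Real.exp_le_exp.2
    have h1 : inner ℝ (‖v‖⁻¹ • v) ((0 - θ • ∑ i, rankOne ℝ (w i) (w i) : E →L[ℝ] E) (‖v‖⁻¹ • v)) =
        -(θ * ((∑ i, inner ℝ v (w i) ^ 2) / ‖v‖ ^ 2)) := by
      simp only [zero_sub, neg_apply, smul_apply, sum_apply, rankOne_apply, inner_neg_right,
        inner_smul_right, inner_sum, inner_smul_left, conj_trivial, Finset.sum_div, Finset.mul_sum]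
      congr 1
      refine Finset.sum_congr rfl fun i _ => ?_
      rw [real_inner_comm v (w i)]
      field_simp
    rw [h1]
    refine neg_le_neg (mul_le_mul_of_nonneg_left ?_ hθ)
    rw [div_le_iff₀ (by positivity)]
    exact hv.le
  have hΦm : AEMeasurable Φ (Measure.pi (fun _ : Fin n => ν)) := by
    apply Measurable.aemeasurable
    apply ENNReal.measurable_ofReal.comp
    apply Continuous.measurable
    refine continuous_trExp.comp (continuous_const.sub (Continuous.const_smul ?_ θ))
    exact continuous_finsetSum _ fun i _ => continuous_rankOne_self.comp (continuous_apply i)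
  have ha0 : 0 < a := Real.exp_pos _
  calc _ ≤ Measure.pi (fun _ : Fin n => ν) {w | ENNReal.ofReal a ≤ Φ w} := measure_mono hsub
    _ ≤ (∫⁻ w, Φ w ∂Measure.pi (fun _ : Fin n => ν)) / ENNReal.ofReal a :=
        meas_ge_le_lintegral_div hΦm (by simpa using ha0) ENNReal.ofReal_ne_top
    _ ≤ ENNReal.ofReal (Real.exp (-c) ^ n * Module.finrank ℝ E) / ENNReal.ofReal a := by
        gcongr
    _ = ENNReal.ofReal (Real.exp (-c) ^ n * Module.finrank ℝ E / a) :=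
        (ENNReal.ofReal_div_of_pos ha0).symm
    _ ≤ _ := by
        apply ENNReal.ofReal_le_ofReal
        have h1 : Real.exp (-c) ^ n / a ≤ Real.exp (-(n * t ^ 2 / (2 * B))) := by
          rw [← Real.exp_nat_mul, ha, ← Real.exp_sub]
          apply Real.exp_le_exp.2
          have h2 := one_sub_exp_neg_ge (x := θ * B) (by positivity)
          have h3 : θ * B = t := by rw [hθ_def]; field_simp
          have h4 : (t - t ^ 2 / 2) / B ≤ c := by
            rw [hc, h3]
            rw [h3] at h2
            gcongr
          have h5 : (n : ℝ) * ((t - t ^ 2 / 2) / B) ≤ n * c := by gcongr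
          have h6 : (n : ℝ) * -c - -(θ * (n * (1 - t))) = n * (t / B) * (1 - t) - n * c := by
            rw [hθ_def]; ring
          rw [h6]
          have h7 : (n : ℝ) * (t / B) * (1 - t) - n * ((t - t ^ 2 / 2) / B) =
            -(n * t ^ 2 / (2 * B)) := by field_simp; ring
          linarith
        calc Real.exp (-c) ^ n * Module.finrank ℝ E / a
            = Module.finrank ℝ E * (Real.exp (-c) ^ n / a) := by ring
          _ ≤ _ := by gcongr

end MatrixChernoff

/-! ### Scalar estimates for sub-gamma tails -/

/-- The optimal Chernoff parameter for a sub-gamma moment generating function. -/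
theorem exists_subgamma_chernoff {v c s : ℝ} (hv : 0 < v) (hc : 0 ≤ c) (hs : 0 ≤ s) :
    ∃ η, 0 ≤ η ∧ c * η < 1 ∧
      v * η ^ 2 / (2 * (1 - c * η)) - η * (Real.sqrt (2 * v * s) + c * s) = -s := by
  set a := Real.sqrt (2 * s / v) with ha
  have ha0 : 0 ≤ a := Real.sqrt_nonneg _
  have ha2 : a ^ 2 = 2 * s / v := Real.sq_sqrt (by positivity)
  have hs' : s = v * a ^ 2 / 2 := by rw [ha2]; field_simp
  have hsq : Real.sqrt (2 * v * s) = v * a := by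
    rw [Real.sqrt_eq_iff_mul_self_eq (by positivity) (by positivity), hs']
    ring
  -- The witness is `η = a / (1 + c a)`, for which `1 - cη = 1 / (1 + c a)`; with `s = v a² / 2` the
  -- threshold becomes `v a + c v a² / 2`.
  have h1 : 0 < 1 + c * a := by positivity
  have h2 : 1 - c * (a / (1 + c * a)) = 1 / (1 + c * a) := by field_simp; ring
  refine ⟨a / (1 + c * a), by positivity, ?_, ?_⟩
  · have : 0 < 1 - c * (a / (1 + c * a)) := by rw [h2]; positivity
    linarith
  · rw [h2, hsq, hs']
    field_simp
    ring

/-- This is `u ≤ sinh u` at `u = -log (1 - y)`. It puts the Gaussian quadratic form into sub-gamma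
form. -/
theorem neg_log_one_sub_le {y : ℝ} (hy0 : 0 ≤ y) (hy1 : y < 1) :
    -Real.log (1 - y) ≤ y + y ^ 2 / (2 * (1 - y)) := by
  have h1 : 0 < 1 - y := by linarith
  have h2 : 0 ≤ -Real.log (1 - y) := by
    have := Real.log_nonpos h1.le (by linarith)
    linarith
  have h3 := Real.self_le_sinh_iff.2 h2
  rw [Real.sinh_eq, neg_neg, Real.exp_neg, Real.exp_log h1] at h3
  refine h3.trans_eq ?_
  field_simp
  ring

/-! ### Nets on the sphere -/

section Net

variable {E : Type*} [NormedAddCommGroup E] [NormedSpace ℝ E] [FiniteDimensional ℝ E]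

open Module Metric in
/-- Volumetric bound for the cardinality of an `ε`-separated subset of the unit ball. -/
theorem card_le_of_separated {ε : ℝ} (hε : 0 < ε) (s : Finset E) (hs : ∀ c ∈ s, ‖c‖ ≤ 1)
    (h : ∀ c ∈ s, ∀ d ∈ s, c ≠ d → ε ≤ ‖c - d‖) : (s.card : ℝ) ≤ (1 + 2 / ε) ^ finrank ℝ E := by
  borelize E
  let μ : Measure E := Measure.addHaar
  have hδ : 0 < ε / 2 := by positivity
  have hρ : 0 < 1 + ε / 2 := by positivity
  set A := ⋃ c ∈ s, ball (c : E) (ε / 2) with hA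
  have D : Set.Pairwise (s : Set E) (Function.onFun Disjoint fun c => ball (c : E) (ε / 2)) := by
    rintro c hc d hd hcd
    apply ball_disjoint_ball
    rw [dist_eq_norm]
    linarith [h c hc d hd hcd]
  have A_subset : A ⊆ ball (0 : E) (1 + ε / 2) := by
    refine Set.iUnion₂_subset fun x hx => ?_
    apply ball_subset_ball'
    rw [dist_zero_right]
    linarith [hs x hx]
  have I : (s.card : ENNReal) * ENNReal.ofReal ((ε / 2) ^ finrank ℝ E) * μ (ball 0 1) ≤
      ENNReal.ofReal ((1 + ε / 2) ^ finrank ℝ E) * μ (ball 0 1) :=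
    calc (s.card : ENNReal) * ENNReal.ofReal ((ε / 2) ^ finrank ℝ E) * μ (ball 0 1) = μ A := by
          rw [hA, measure_biUnion_finset D fun c _ => measurableSet_ball]
          simp only [μ.addHaar_ball_of_pos _ hδ]
          simp only [Finset.sum_const, nsmul_eq_mul, mul_assoc]
      _ ≤ μ (ball (0 : E) (1 + ε / 2)) := measure_mono A_subset
      _ = ENNReal.ofReal ((1 + ε / 2) ^ finrank ℝ E) * μ (ball 0 1) := by
          simp only [μ.addHaar_ball_of_pos _ hρ]
  have J : (s.card : ENNReal) * ENNReal.ofReal ((ε / 2) ^ finrank ℝ E) ≤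
      ENNReal.ofReal ((1 + ε / 2) ^ finrank ℝ E) :=
    (ENNReal.mul_le_mul_iff_left (measure_ball_pos _ _ zero_lt_one).ne' measure_ball_lt_top.ne).1 I
  have K := ENNReal.toReal_le_of_le_ofReal (pow_nonneg hρ.le _) J
  rw [ENNReal.toReal_mul, ENNReal.toReal_natCast, ENNReal.toReal_ofReal (by positivity),
    ← le_div_iff₀ (by positivity), ← div_pow] at K
  refine K.trans_eq ?_
  congr 1
  field_simp
  ring

open Module in
/-- The unit sphere has an `ε`-net of cardinality at most `(1 + 2 / ε) ^ dim`. -/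
theorem exists_finset_net_sphere {ε : ℝ} (hε : 0 < ε) :
    ∃ s : Finset E, (∀ c ∈ s, ‖c‖ = 1) ∧ (s.card : ℝ) ≤ (1 + 2 / ε) ^ finrank ℝ E ∧
      ∀ x : E, ‖x‖ = 1 → ∃ c ∈ s, ‖x - c‖ ≤ ε := by
  classical
  let p : Finset E → Prop := fun s =>
    (∀ c ∈ s, ‖c‖ = 1) ∧ ∀ c ∈ s, ∀ d ∈ s, c ≠ d → ε ≤ ‖c - d‖
  have hp : ∀ s, p s → (s.card : ℝ) ≤ (1 + 2 / ε) ^ finrank ℝ E := fun s hs =>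
    card_le_of_separated hε s (fun c hc => (hs.1 c hc).le) hs.2
  -- The volumetric bound caps these cardinalities, so one is maximal. A separated set of maximal
  -- cardinality is a net: a point farther than `ε` from all its members could be added.
  let T : Set ℕ := {k | ∃ s, p s ∧ s.card = k}
  have hT : T.Nonempty := ⟨0, ∅, ⟨by simp, by simp⟩, by simp⟩
  have hTb : BddAbove T := by
    refine ⟨⌊(1 + 2 / ε) ^ finrank ℝ E⌋₊, ?_⟩
    rintro k ⟨s, hs, rfl⟩
    exact Nat.le_floor (hp s hs)
  obtain ⟨s, hs, hcard⟩ := Nat.sSup_mem hT hTb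
  refine ⟨s, hs.1, hp s hs, fun x hx => ?_⟩
  by_contra! hcon
  have hx' : x ∉ s := fun hxs => by
    have := hcon x hxs
    simp at this
    linarith
  have hins : p (insert x s) := by
    refine ⟨?_, ?_⟩
    · intro c hc
      rcases Finset.mem_insert.1 hc with rfl | hc
      · exact hx
      · exact hs.1 c hc
    · intro c hc d hd hcd
      rcases Finset.mem_insert.1 hc with rfl | hc' <;> rcases Finset.mem_insert.1 hd with rfl | hd'
      · exact absurd rfl hcd
      · exact (hcon d hd').le
      · rw [norm_sub_rev]
        exact (hcon c hc').le
      · exact hs.2 c hc' d hd' hcd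
  have := le_csSup hTb (show (insert x s).card ∈ T from ⟨_, hins, rfl⟩)
  rw [Finset.card_insert_of_notMem hx', hcard] at this
  omega

end Net

/-- A quadratic form which is small on an `ε`-net of the sphere is small on the sphere. -/
theorem abs_inner_le_of_net {E : Type*} [NormedAddCommGroup E] [InnerProductSpace ℝ E]
    {T : E →L[ℝ] E} (hT : T.IsSymmetric) {s : Finset E} {ε τ : ℝ} (hε : 2 * ε < 1) (hε0 : 0 ≤ ε)
    (hτ : 0 ≤ τ)
    (hs1 : ∀ c ∈ s, ‖c‖ = 1) (hnet : ∀ x : E, ‖x‖ = 1 → ∃ c ∈ s, ‖x - c‖ ≤ ε)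
    (hsmall : ∀ c ∈ s, |inner ℝ c (T c)| ≤ τ) (x : E) :
    |inner ℝ x (T x)| ≤ τ / (1 - 2 * ε) * ‖x‖ ^ 2 := by
  have hunit : ∀ x : E, ‖x‖ = 1 → |inner ℝ x (T x)| ≤ τ + 2 * ε * ‖T‖ := by
    intro x hx
    obtain ⟨c, hc, hxc⟩ := hnet x hx
    have e : inner ℝ x (T x) = inner ℝ c (T c) + (inner ℝ (x - c) (T x) + inner ℝ c (T (x - c))) := by
      rw [map_sub, inner_sub_left, inner_sub_right]
      ring
    have b1 : |inner ℝ (x - c) (T x)| ≤ ε * ‖T‖ := by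
      refine (abs_real_inner_le_norm _ _).trans ?_
      have := T.le_opNorm x
      rw [hx, mul_one] at this
      gcongr
    have b2 : |inner ℝ c (T (x - c))| ≤ ε * ‖T‖ := by
      refine (abs_real_inner_le_norm _ _).trans ?_
      rw [hs1 c hc, one_mul, mul_comm]
      exact (T.le_opNorm _).trans (by gcongr)
    rw [e]
    calc _ ≤ |inner ℝ c (T c)| + (|inner ℝ (x - c) (T x)| + |inner ℝ c (T (x - c))|) :=
          (abs_add_le _ _).trans (by gcongr; exact abs_add_le _ _)
      _ ≤ τ + 2 * ε * ‖T‖ := by linarith [hsmall c hc]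
  -- For symmetric `T` the norm is the supremum of the absolute Rayleigh quotients, so the bound on
  -- unit vectors is self-improving and can be solved for `‖T‖`.
  have hnorm : ‖T‖ ≤ τ + 2 * ε * ‖T‖ := by
    conv_lhs => rw [ContinuousLinearMap.norm_eq_iSup_rayleighQuotient T hT]
    refine ciSup_le fun x => ?_
    rw [ContinuousLinearMap.rayleighQuotient, ContinuousLinearMap.reApplyInnerSelf_apply]
    -- At `x = 0` the quotient is `0 / 0 = 0`.
    rcases eq_or_ne x 0 with rfl | hx
    · simp
      positivity
    have hnx : 0 < ‖x‖ := norm_pos_iff.2 hx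
    have h1 := hunit (‖x‖⁻¹ • x) (by rw [norm_smul, norm_inv, norm_norm, inv_mul_cancel₀ hnx.ne'])
    rw [map_smul, inner_smul_left, inner_smul_right, conj_trivial] at h1
    have e : RCLike.re (inner ℝ (T x) x) / ‖x‖ ^ 2 = ‖x‖⁻¹ * (‖x‖⁻¹ * inner ℝ x (T x)) := by
      rw [real_inner_comm, RCLike.re_to_real]
      field_simp
    rw [e]
    exact h1
  have hnorm' : ‖T‖ ≤ τ / (1 - 2 * ε) := by
    rw [le_div_iff₀ (by linarith)]
    linarith
  calc |inner ℝ x (T x)| ≤ ‖x‖ * ‖T x‖ := abs_real_inner_le_norm _ _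
    _ ≤ ‖x‖ * (‖T‖ * ‖x‖) := by gcongr; exact T.le_opNorm x
    _ = ‖T‖ * ‖x‖ ^ 2 := by ring
    _ ≤ _ := by gcongr

/-! ### Squares of subgaussian variables and Bernstein's inequality -/

section SubgaussianSquare

variable {Ω : Type*} [MeasurableSpace Ω] {P : Measure Ω} [IsProbabilityMeasure P]

theorem measure_sq_ge_le_of_subgaussian {Z : Ω → ℝ} {ρ : NNReal} (hZ : HasSubgaussianMGF Z ρ P)
    {t : ℝ} (ht : 0 ≤ t) :
    P {ω | t ≤ Z ω ^ 2} ≤ ENNReal.ofReal (2 * Real.exp (-(t / (2 * ρ)))) := by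
  have hsub : {ω | t ≤ Z ω ^ 2} ⊆ {ω | Real.sqrt t ≤ Z ω} ∪ {ω | Real.sqrt t ≤ (-Z) ω} := by
    intro ω hω
    have h1 : Real.sqrt t ≤ |Z ω| := by
      rw [← Real.sqrt_sq_eq_abs]
      exact Real.sqrt_le_sqrt hω
    rcases le_abs.1 h1 with h | h
    · exact Or.inl h
    · exact Or.inr h
  have hbd : ∀ {Z : Ω → ℝ}, HasSubgaussianMGF Z ρ P →
      P {ω | Real.sqrt t ≤ Z ω} ≤ ENNReal.ofReal (Real.exp (-(t / (2 * ρ)))) := by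
    intro Z hZ
    have := hZ.measure_ge_le (Real.sqrt_nonneg t)
    rw [Real.sq_sqrt ht] at this
    rw [← ofReal_measureReal]
    refine ENNReal.ofReal_le_ofReal (this.trans_eq ?_)
    rw [neg_div]
  calc P {ω | t ≤ Z ω ^ 2} ≤ P {ω | Real.sqrt t ≤ Z ω} + P {ω | Real.sqrt t ≤ (-Z) ω} :=
        (measure_mono hsub).trans (measure_union_le _ _)
    _ ≤ ENNReal.ofReal (Real.exp (-(t / (2 * ρ)))) + ENNReal.ofReal (Real.exp (-(t / (2 * ρ)))) :=
        add_le_add (hbd hZ) (hbd hZ.neg)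
    _ = _ := by
        rw [← ENNReal.ofReal_add (by positivity) (by positivity)]
        ring_nf

/-- The exponential remainder of the square of a subgaussian variable. -/
theorem integral_exp_remainder_sq_le {Z : Ω → ℝ} {ρ : NNReal} (hZ : HasSubgaussianMGF Z ρ P)
    (hρ : 0 < ρ) {η : ℝ} (hη : 0 ≤ η) (hη1 : 2 * ρ * η < 1) :
    Integrable (fun ω => Real.exp (η * Z ω ^ 2) - 1 - η * Z ω ^ 2) P ∧
      ∫ ω, (Real.exp (η * Z ω ^ 2) - 1 - η * Z ω ^ 2) ∂P ≤
        8 * (ρ : ℝ) ^ 2 * η ^ 2 / (1 - 2 * ρ * η) := by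
  have hρ' : (0 : ℝ) < ρ := hρ
  set a : ℝ := 1 / (2 * ρ) with ha
  have ha0 : 0 < a := by positivity
  have haη : η < a := by rw [ha, lt_div_iff₀ (by positivity)]; linarith
  have hZm : AEMeasurable Z P := hZ.aemeasurable
  set G : ℝ → ℝ := fun x => Real.exp (η * x) - 1 - η * x with hG
  set g : ℝ → ℝ := fun x => η * Real.exp (η * x) - η with hg
  have hgc : Continuous g := by fun_prop
  have hGnn : ∀ x, 0 ≤ G x := fun x => by
    have := Real.add_one_le_exp (η * x)
    simp only [hG]
    linarith
  have hGd : ∀ x, HasDerivAt G (g x) x := fun x => by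
    have h1 : HasDerivAt (fun x => η * x) η x := by simpa using (hasDerivAt_id x).const_mul η
    have h2 := (h1.exp.sub_const 1).sub h1
    convert! h2 using 1
    simp only [hg]
    ring
  have hFTC : ∀ x, ∫ t in (0 : ℝ)..x, g t = G x := fun x => by
    rw [intervalIntegral.integral_eq_sub_of_hasDerivAt (fun t _ => hGd t)
      (hgc.intervalIntegrable _ _)]
    simp [hG]
  have hgnn : ∀ t, 0 ≤ t → 0 ≤ g t := fun t ht => by
    have : 1 ≤ Real.exp (η * t) := Real.one_le_exp (by positivity)
    simp only [hg]
    nlinarith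
  -- Layer cake: `E G(Z²) = ∫ P(Z² ≥ t) g(t) dt` with `g = G'`. Inserting the tail `2 exp(-a t)`, `a
  -- = 1/(2ρ)`, gives `2η (1/(a - η) - 1/a)`, the stated constant.
  have hlc := lintegral_comp_eq_lintegral_meas_le_mul P (f := fun ω => Z ω ^ 2) (g := g)
    (Filter.Eventually.of_forall fun ω => sq_nonneg _) (hZm.pow_const 2)
    (fun t _ => hgc.intervalIntegrable _ _)
    ((ae_restrict_mem measurableSet_Ioi).mono fun t ht => hgnn t (le_of_lt ht))
  simp only [hFTC] at hlc
  set k : ℝ → ℝ := fun t => 2 * η * Real.exp ((η - a) * t) - 2 * η * Real.exp (-a * t) with hk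
  have hkI : IntegrableOn k (Set.Ioi 0) :=
    ((integrableOn_exp_mul_Ioi (sub_neg.2 haη) 0).const_mul _).sub
      ((integrableOn_exp_mul_Ioi (neg_neg_of_pos ha0) 0).const_mul _)
  have hkg : ∀ t, k t = 2 * Real.exp (-(t / (2 * ρ))) * g t := fun t => by
    have e1 : Real.exp ((η - a) * t) = Real.exp (-(t / (2 * ρ))) * Real.exp (η * t) := by
      rw [← Real.exp_add, ha]
      ring_nf
    have e2 : Real.exp (-a * t) = Real.exp (-(t / (2 * ρ))) := by
      rw [ha]
      ring_nf
    simp only [hk, hg, e1, e2]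
    ring
  have hval : ∫ t in Set.Ioi 0, k t = 8 * (ρ : ℝ) ^ 2 * η ^ 2 / (1 - 2 * ρ * η) := by
    simp only [hk]
    rw [integral_sub ((integrableOn_exp_mul_Ioi (sub_neg.2 haη) 0).const_mul _)
      ((integrableOn_exp_mul_Ioi (neg_neg_of_pos ha0) 0).const_mul _), integral_const_mul,
      integral_const_mul, integral_exp_mul_Ioi (sub_neg.2 haη) 0,
      integral_exp_mul_Ioi (neg_neg_of_pos ha0) 0]
    have h1 : η - a ≠ 0 := (sub_neg.2 haη).ne
    have h2 : 1 - 2 * (ρ : ℝ) * η ≠ 0 := by linarith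
    have h3 : η - a = -(1 - 2 * ρ * η) / (2 * ρ) := by rw [ha]; field_simp; ring
    rw [h3, ha]
    simp only [mul_zero, Real.exp_zero]
    generalize hD : 1 - 2 * (ρ : ℝ) * η = D at h2
    field_simp
    rw [← hD]
    ring
  have hle : ∫⁻ ω, ENNReal.ofReal (G (Z ω ^ 2)) ∂P ≤
      ENNReal.ofReal (8 * (ρ : ℝ) ^ 2 * η ^ 2 / (1 - 2 * ρ * η)) := by
    rw [hlc, ← hval, ofReal_integral_eq_lintegral_ofReal hkI]
    · refine setLIntegral_mono' measurableSet_Ioi fun t ht => ?_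
      rw [hkg, ENNReal.ofReal_mul (by positivity)]
      gcongr
      exact measure_sq_ge_le_of_subgaussian hZ (le_of_lt ht)
    · refine (ae_restrict_mem measurableSet_Ioi).mono fun t ht => ?_
      simp only [hkg, Pi.zero_apply]
      exact mul_nonneg (by positivity) (hgnn t (le_of_lt ht))
  have hGm : AEStronglyMeasurable (fun ω => G (Z ω ^ 2)) P := by
    have hGc : Continuous G := by fun_prop
    exact (hGc.measurable.comp_aemeasurable (hZm.pow_const 2)).aestronglyMeasurable
  have hnn : 0 ≤ᵐ[P] fun ω => G (Z ω ^ 2) := Filter.Eventually.of_forall fun ω => hGnn _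
  have hI : Integrable (fun ω => G (Z ω ^ 2)) P :=
    (lintegral_ofReal_ne_top_iff_integrable hGm hnn).1
      (ne_top_of_le_ne_top ENNReal.ofReal_ne_top hle)
  refine ⟨hI, ?_⟩
  rw [← ofReal_integral_eq_lintegral_ofReal hI hnn] at hle
  refine (ENNReal.ofReal_le_ofReal_iff ?_).1 hle
  exact div_nonneg (by positivity) (by linarith)

/-- Two-sided sub-gamma bound for the centred square of a subgaussian variable. -/
theorem integral_exp_centered_sq_le {Z : Ω → ℝ} {ρ : NNReal} (hZ : HasSubgaussianMGF Z ρ P)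
    (hρ : 0 < ρ) (hZ2 : Integrable (fun ω => Z ω ^ 2) P) (hvar : ∫ ω, Z ω ^ 2 ∂P = 1)
    {η ε : ℝ} (hη : 0 ≤ η) (hη1 : 2 * ρ * η < 1) (hε : ε = 1 ∨ ε = -1) :
    ∫⁻ ω, ENNReal.ofReal (Real.exp (η * (ε * (Z ω ^ 2 - 1)))) ∂P ≤
      ENNReal.ofReal (Real.exp (8 * (ρ : ℝ) ^ 2 * η ^ 2 / (1 - 2 * ρ * η))) := by
  obtain ⟨hI, hle⟩ := integral_exp_remainder_sq_le hZ hρ hη hη1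
  set ψ := 8 * (ρ : ℝ) ^ 2 * η ^ 2 / (1 - 2 * ρ * η)
  set R : Ω → ℝ := fun ω => Real.exp (η * Z ω ^ 2) - 1 - η * Z ω ^ 2 with hR
  -- One remainder serves both signs: for `ε = 1` this is an equality, and for `ε = -1` it reads
  -- `exp(-x) ≤ exp x - 2x`, that is `x ≤ sinh x`.
  have hpt : ∀ ω, Real.exp (η * (ε * (Z ω ^ 2 - 1))) ≤
      Real.exp (-(ε * η)) * (1 + ε * η * Z ω ^ 2 + R ω) := by
    intro ω
    have e : η * (ε * (Z ω ^ 2 - 1)) = -(ε * η) + ε * (η * Z ω ^ 2) := by ring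
    rw [e, Real.exp_add]
    gcongr
    have hx : 0 ≤ η * Z ω ^ 2 := by positivity
    rcases hε with rfl | rfl
    · simp only [hR]
      simp only [one_mul]
      linarith
    · have h := Real.self_le_sinh_iff.2 hx
      rw [Real.sinh_eq] at h
      simp only [hR, neg_mul, one_mul]
      linarith
  have hI1 : Integrable (fun ω => 1 + ε * η * Z ω ^ 2) P :=
    (integrable_const _).add (hZ2.const_mul _)
  have hI2 : Integrable (fun ω => Real.exp (-(ε * η)) * (1 + ε * η * Z ω ^ 2 + R ω)) P :=
    (hI1.add hI).const_mul _
  calc ∫⁻ ω, ENNReal.ofReal (Real.exp (η * (ε * (Z ω ^ 2 - 1)))) ∂P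
      ≤ ∫⁻ ω, ENNReal.ofReal (Real.exp (-(ε * η)) * (1 + ε * η * Z ω ^ 2 + R ω)) ∂P :=
        lintegral_mono fun ω => ENNReal.ofReal_le_ofReal (hpt ω)
    _ = ENNReal.ofReal (∫ ω, Real.exp (-(ε * η)) * (1 + ε * η * Z ω ^ 2 + R ω) ∂P) :=
        (ofReal_integral_eq_lintegral_ofReal hI2 (Filter.Eventually.of_forall fun ω =>
          (Real.exp_pos _).le.trans (hpt ω))).symm
    _ ≤ ENNReal.ofReal (Real.exp ψ) := by
        apply ENNReal.ofReal_le_ofReal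
        rw [integral_const_mul, integral_add hI1 hI, integral_add (integrable_const _)
          (hZ2.const_mul _), integral_const_mul, hvar]
        simp only [integral_const, probReal_univ, one_smul, mul_one]
        have h1 : 1 + ε * η + ∫ ω, R ω ∂P ≤ Real.exp (ε * η + ψ) := by
          have := Real.add_one_le_exp (ε * η + ψ)
          linarith
        calc Real.exp (-(ε * η)) * (1 + ε * η + ∫ ω, R ω ∂P)
            ≤ Real.exp (-(ε * η)) * Real.exp (ε * η + ψ) := by gcongr
          _ = Real.exp ψ := by rw [← Real.exp_add]; ring_nf

end SubgaussianSquare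

section Chernoff

variable {α : Type*} [MeasurableSpace α] {ν : Measure α}

theorem lintegral_pi_prod [SigmaFinite ν] {f : α → ENNReal} (hf : Measurable f) (n : ℕ) :
    ∫⁻ z, ∏ i, f (z i) ∂Measure.pi (fun _ : Fin n => ν) = (∫⁻ x, f x ∂ν) ^ n := by
  induction n with
  | zero => simp
  | succ n ih =>
    rw [lintegral_pi_succ ν (by fun_prop)]
    simp only [Fin.prod_univ_succ, Fin.cons_zero, Fin.cons_succ]
    have : ∀ x, ∫⁻ y, f x * ∏ i, f (y i) ∂Measure.pi (fun _ : Fin n => ν) =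
        f x * (∫⁻ x, f x ∂ν) ^ n := fun x => by
      rw [lintegral_const_mul _ (by fun_prop), ih]
    simp only [this]
    rw [lintegral_mul_const _ hf, pow_succ, mul_comm]

/-- Chernoff's bound for a sum of independent copies. -/
theorem measure_pi_sum_ge_le [SigmaFinite ν] {f : α → ℝ} (hf : Measurable f) {ψ : ℝ}
    (hψ : ∫⁻ x, ENNReal.ofReal (Real.exp (f x)) ∂ν ≤ ENNReal.ofReal (Real.exp ψ)) (n : ℕ) (c : ℝ) :
    Measure.pi (fun _ : Fin n => ν) {z | c ≤ ∑ i, f (z i)} ≤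
      ENNReal.ofReal (Real.exp (n * ψ - c)) := by
  have hg : Measurable fun x => ENNReal.ofReal (Real.exp (f x)) := by fun_prop
  have hsub : {z : Fin n → α | c ≤ ∑ i, f (z i)} ⊆
      {z | ENNReal.ofReal (Real.exp c) ≤ ∏ i, ENNReal.ofReal (Real.exp (f (z i)))} := by
    intro z hz
    simp only [Set.mem_ofPred_eq] at hz ⊢
    rw [← ENNReal.ofReal_prod_of_nonneg (fun i _ => (Real.exp_pos _).le), ← Real.exp_sum]
    exact ENNReal.ofReal_le_ofReal (Real.exp_le_exp.2 hz)
  refine (measure_mono hsub).trans ?_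
  refine (meas_ge_le_lintegral_div (Measurable.aemeasurable (by fun_prop)) (by simpa using Real.exp_pos c)
    ENNReal.ofReal_ne_top).trans ?_
  rw [lintegral_pi_prod hg]
  calc (∫⁻ x, ENNReal.ofReal (Real.exp (f x)) ∂ν) ^ n / ENNReal.ofReal (Real.exp c)
      ≤ ENNReal.ofReal (Real.exp ψ) ^ n / ENNReal.ofReal (Real.exp c) := by gcongr
    _ = ENNReal.ofReal (Real.exp (n * ψ - c)) := by
        rw [← ENNReal.ofReal_pow (Real.exp_pos _).le, ← ENNReal.ofReal_div_of_pos (Real.exp_pos _),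
          ← Real.exp_nat_mul, ← Real.exp_sub]

/-- Bernstein's inequality for the empirical second moment of a subgaussian variable. -/
theorem measure_pi_abs_sum_centered_sq_ge_le [IsProbabilityMeasure ν] {Z : α → ℝ}
    (hZm : Measurable Z) {ρ : NNReal} (hZ : HasSubgaussianMGF Z ρ ν) (hρ : 0 < ρ)
    (hZ2 : Integrable (fun x => Z x ^ 2) ν) (hvar : ∫ x, Z x ^ 2 ∂ν = 1) {n : ℕ} (hn : 0 < n)
    {s : ℝ} (hs : 0 ≤ s) :
    Measure.pi (fun _ : Fin n => ν) {z | n * (ρ * (Real.sqrt (32 * s / n) + 2 * s / n)) ≤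
        |∑ i, (Z (z i) ^ 2 - 1)|} ≤ ENNReal.ofReal (2 * Real.exp (-s)) := by
  have hρ' : (0 : ℝ) < ρ := hρ
  have hn' : (0 : ℝ) < n := Nat.cast_pos.2 hn
  -- The values of `v` and `c` make `8ρ²η²/(1 - 2ρη)` equal to `vη²/(2(1 - cη))`; each of the `n`
  -- samples carries `s / n` of the exponent.
  obtain ⟨η, hη0, hη1, hη⟩ := exists_subgamma_chernoff (v := 16 * (ρ : ℝ) ^ 2) (c := 2 * ρ)
    (s := s / n) (by positivity) (by positivity) (by positivity)
  set τ : ℝ := ρ * (Real.sqrt (32 * s / n) + 2 * s / n) with hτ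
  have hsqrt : Real.sqrt (2 * (16 * (ρ : ℝ) ^ 2) * (s / n)) + 2 * ρ * (s / n) = τ := by
    have e : 2 * (16 * (ρ : ℝ) ^ 2) * (s / n) = ρ ^ 2 * (32 * s / n) := by ring
    rw [e, Real.sqrt_mul (by positivity), Real.sqrt_sq hρ'.le, hτ]
    ring
  rw [hsqrt] at hη
  have hψ : 16 * (ρ : ℝ) ^ 2 * η ^ 2 / (2 * (1 - 2 * ρ * η)) =
      8 * (ρ : ℝ) ^ 2 * η ^ 2 / (1 - 2 * ρ * η) := by
    have : 1 - 2 * ρ * η ≠ 0 := by linarith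
    field_simp
    ring
  rw [hψ] at hη
  set ψ := 8 * (ρ : ℝ) ^ 2 * η ^ 2 / (1 - 2 * ρ * η)
  have hexp : (n : ℝ) * ψ - η * (n * τ) = -s := by
    have : (n : ℝ) * ψ - η * (n * τ) = n * (ψ - η * τ) := by ring
    rw [this, hη]
    field_simp
  have hside : ∀ ε : ℝ, ε = 1 ∨ ε = -1 →
      Measure.pi (fun _ : Fin n => ν) {z | η * (n * τ) ≤ ∑ i, η * (ε * (Z (z i) ^ 2 - 1))} ≤
        ENNReal.ofReal (Real.exp (-s)) := by
    intro ε hε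
    have h := measure_pi_sum_ge_le (ν := ν) (f := fun x => η * (ε * (Z x ^ 2 - 1)))
      (by fun_prop) (integral_exp_centered_sq_le hZ hρ hZ2 hvar hη0 hη1 hε) n (η * (n * τ))
    rwa [hexp] at h
  have hsub : {z : Fin n → α | n * τ ≤ |∑ i, (Z (z i) ^ 2 - 1)|} ⊆
      {z | η * (n * τ) ≤ ∑ i, η * (1 * (Z (z i) ^ 2 - 1))} ∪
      {z | η * (n * τ) ≤ ∑ i, η * (-1 * (Z (z i) ^ 2 - 1))} := by
    intro z hz
    simp only [Set.mem_union, Set.mem_ofPred_eq, ← Finset.mul_sum, one_mul, neg_one_mul,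
      Finset.sum_neg_distrib] at hz ⊢
    rcases le_abs.1 hz with h | h
    · exact Or.inl (mul_le_mul_of_nonneg_left h hη0)
    · exact Or.inr (mul_le_mul_of_nonneg_left h hη0)
  refine (measure_mono hsub).trans ((measure_union_le _ _).trans ?_)
  refine (add_le_add (hside 1 (Or.inl rfl)) (hside (-1) (Or.inr rfl))).trans_eq ?_
  rw [← ENNReal.ofReal_add (by positivity) (by positivity)]
  ring_nf

end Chernoff

open InnerProductSpace in
/-- Lower tail of the smallest eigenvalue of the empirical second moment of independent isotropic
vectors with subgaussian projections. -/
theorem measure_pi_exists_sum_sq_lt_le_of_subgaussian {E : Type*} [NormedAddCommGroup E]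
    [InnerProductSpace ℝ E] [FiniteDimensional ℝ E] [MeasurableSpace E] [BorelSpace E]
    {ν : Measure E} [IsProbabilityMeasure ν] {ρ : NNReal} (hρ : 0 < ρ)
    (hsg : ∀ u : E, ‖u‖ = 1 → HasSubgaussianMGF (fun w => inner ℝ u w) ρ ν)
    (hsqInt : ∀ v : E, Integrable (fun w => inner ℝ v w ^ 2) ν)
    (hiso : ∀ v : E, ∫ w, inner ℝ v w ^ 2 ∂ν = ‖v‖ ^ 2) {n : ℕ} (hn : 0 < n)
    {s : ℝ} (hs : 0 ≤ s) :
    Measure.pi (fun _ : Fin n => ν) {w | ∃ v : E, ∑ i, inner ℝ v (w i) ^ 2 <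
        n * (1 - 10 * ρ / 9 * (Real.sqrt (32 * s / n) + 2 * s / n)) * ‖v‖ ^ 2} ≤
      ENNReal.ofReal (41 ^ Module.finrank ℝ E * (2 * Real.exp (-s))) := by
  have hρ' : (0 : ℝ) < ρ := hρ
  have hn' : (0 : ℝ) < n := Nat.cast_pos.2 hn
  -- The choice `ε = 1/20` produces both constants: `1 + 2/ε = 41` and `1/(1 - 2ε) = 10/9`.
  obtain ⟨N, hN1, hNcard, hNnet⟩ := exists_finset_net_sphere (E := E) (ε := 1 / 20) (by norm_num)
  set τ : ℝ := ρ * (Real.sqrt (32 * s / n) + 2 * s / n) with hτ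
  have hτ0 : 0 ≤ τ := by positivity
  have hsub : {w : Fin n → E | ∃ v : E, ∑ i, inner ℝ v (w i) ^ 2 <
        n * (1 - 10 * ρ / 9 * (Real.sqrt (32 * s / n) + 2 * s / n)) * ‖v‖ ^ 2} ⊆
      ⋃ c ∈ N, {w : Fin n → E | n * τ ≤ |∑ i, (inner ℝ c (w i) ^ 2 - 1)|} := by
    rintro w ⟨v, hv⟩
    by_contra hcon
    simp only [Set.mem_iUnion, Set.mem_ofPred_eq, not_exists, not_le] at hcon
    set T : E →L[ℝ] E := (n : ℝ)⁻¹ • ∑ i, rankOne ℝ (w i) (w i) - 1 with hT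
    have hTsym : T.IsSymmetric := by
      intro x y
      simp only [hT, ContinuousLinearMap.coe_coe, sub_apply, smul_apply, sum_apply,
        rankOne_apply, inner_sub_left, inner_sub_right, inner_smul_left, inner_smul_right,
        sum_inner, inner_sum, conj_trivial, one_apply_eq_self]
      congr 2
      refine Finset.sum_congr rfl fun i _ => ?_
      rw [real_inner_comm x (w i), mul_comm]
    have hTq : ∀ x, inner ℝ x (T x) = (n : ℝ)⁻¹ * ∑ i, inner ℝ x (w i) ^ 2 - ‖x‖ ^ 2 := by
      intro x
      simp only [hT, sub_apply, smul_apply, sum_apply, rankOne_apply, inner_sub_right,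
        inner_smul_right, inner_sum, one_apply_eq_self, real_inner_self_eq_norm_sq]
      congr 2
      refine Finset.sum_congr rfl fun i _ => ?_
      rw [real_inner_comm x (w i), sq]
    have h := abs_inner_le_of_net hTsym (s := N) (ε := 1 / 20) (τ := τ) (by norm_num)
      (by norm_num) hτ0 hN1 hNnet (by
        intro c hc
        have h1 := (hcon c hc).le
        have h2 : inner ℝ c (T c) = (n : ℝ)⁻¹ * ∑ i, (inner ℝ c (w i) ^ 2 - 1) := by
          rw [hTq, hN1 c hc, Finset.sum_sub_distrib]
          simp
          field_simp
        rw [h2, abs_mul, abs_of_pos (inv_pos.2 hn'), inv_mul_le_iff₀ hn']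
        exact h1) v
    have h3 := neg_le_of_abs_le h
    rw [hTq] at h3
    have h4 : ∑ i, inner ℝ v (w i) ^ 2 = n * ((n : ℝ)⁻¹ * ∑ i, inner ℝ v (w i) ^ 2) := by
      field_simp
    have h5 : (n : ℝ) * (1 - 10 * ρ / 9 * (Real.sqrt (32 * s / n) + 2 * s / n)) * ‖v‖ ^ 2 =
        n * (‖v‖ ^ 2 - τ / (1 - 2 * (1 / 20)) * ‖v‖ ^ 2) := by
      rw [hτ]
      ring
    rw [h4, h5] at hv
    have h6 := lt_of_mul_lt_mul_left hv hn'.le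
    linarith
  calc _ ≤ ∑ c ∈ N, Measure.pi (fun _ : Fin n => ν)
          {w : Fin n → E | n * τ ≤ |∑ i, (inner ℝ c (w i) ^ 2 - 1)|} :=
        (measure_mono hsub).trans (measure_biUnion_finset_le _ _)
    _ ≤ ∑ c ∈ N, ENNReal.ofReal (2 * Real.exp (-s)) := by
        refine Finset.sum_le_sum fun c hc => ?_
        refine measure_pi_abs_sum_centered_sq_ge_le (Z := fun w => inner ℝ c w) (by fun_prop)
          (hsg c (hN1 c hc)) hρ (hsqInt c) ?_ hn hs
        rw [hiso, hN1 c hc, one_pow]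
    _ = ENNReal.ofReal (N.card * (2 * Real.exp (-s))) := by
        rw [Finset.sum_const, nsmul_eq_mul, ENNReal.ofReal_mul (Nat.cast_nonneg N.card),
          ENNReal.ofReal_natCast]
    _ ≤ _ := by
        apply ENNReal.ofReal_le_ofReal
        gcongr
        refine hNcard.trans_eq ?_
        norm_num

/-! ### Conditionally subgaussian noise: tensorisation -/

section ConditionalSubgaussian

/-- Test a bound on a conditional expectation given `X` against nonnegative functions of `X`. -/
theorem lintegral_comp_mul_ofReal_le_of_condExp_le {Ω α : Type*} [mΩ : MeasurableSpace Ω]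
    [mα : MeasurableSpace α] {P : Measure Ω} [IsProbabilityMeasure P] {X : Ω → α}
    (hX : Measurable X) {g : Ω → ℝ} (hgm : Measurable g) (hg0 : ∀ ω, 0 ≤ g ω)
    (hgi : Integrable g P) {c : ℝ} (hc : 0 ≤ c)
    (hle : ∀ᵐ ω ∂P, (P[g | MeasurableSpace.comap X mα]) ω ≤ c)
    {f : α → ENNReal} (hf : Measurable f) :
    ∫⁻ ω, f (X ω) * ENNReal.ofReal (g ω) ∂P ≤ ENNReal.ofReal c * ∫⁻ ω, f (X ω) ∂P := by
  have hgm' : Measurable fun ω => ENNReal.ofReal (g ω) := by fun_prop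
  -- Comparing measures on sets suffices, and over a set `X ⁻¹' S` the function `g` has the same
  -- integral as its conditional expectation.
  have hμ : (P.withDensity fun ω => ENNReal.ofReal (g ω)).map X ≤ ENNReal.ofReal c • P.map X := by
    refine Measure.le_iff.2 fun S hS => ?_
    have hXS : MeasurableSet (X ⁻¹' S) := hX hS
    rw [Measure.map_apply hX hS, withDensity_apply _ hXS, Measure.smul_apply,
      Measure.map_apply hX hS, smul_eq_mul,
      ← ofReal_integral_eq_lintegral_ofReal hgi.integrableOn
        (Filter.Eventually.of_forall fun ω => hg0 ω),
      ← setIntegral_condExp hX.comap_le hgi ⟨S, hS, rfl⟩, ← ofReal_measureReal,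
      ← ENNReal.ofReal_mul hc]
    apply ENNReal.ofReal_le_ofReal
    calc ∫ ω in X ⁻¹' S, (P[g | MeasurableSpace.comap X mα]) ω ∂P
        ≤ ∫ _ω in X ⁻¹' S, c ∂P :=
          setIntegral_mono_ae integrable_condExp.integrableOn (integrable_const c).integrableOn hle
      _ = c * P.real (X ⁻¹' S) := by simp [mul_comm]
  calc ∫⁻ ω, f (X ω) * ENNReal.ofReal (g ω) ∂P
      = ∫⁻ x, f x ∂((P.withDensity fun ω => ENNReal.ofReal (g ω)).map X) := by
        have hfX : Measurable fun ω => f (X ω) := hf.comp hX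
        rw [lintegral_map hf hX, lintegral_withDensity_eq_lintegral_mul _ hgm' hfX]
        simp only [Pi.mul_apply, mul_comm]
    _ ≤ ∫⁻ x, f x ∂(ENNReal.ofReal c • P.map X) := lintegral_mono' hμ le_rfl
    _ = _ := by rw [lintegral_smul_measure, lintegral_map hf hX, smul_eq_mul]

/-- `r` is subgaussian conditionally on `X`, with variance proxy `v`, tested against nonnegative
functions of `X`. -/
def CondSubgaussian {β α : Type*} [MeasurableSpace β] [MeasurableSpace α] (ν : Measure β)
    (X : β → α) (r : β → ℝ) (v : ℝ) : Prop :=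
  ∀ (q : ℝ) (f : α → ENNReal), Measurable f →
    ∫⁻ z, f (X z) * ENNReal.ofReal (Real.exp (q * r z)) ∂ν ≤
      ENNReal.ofReal (Real.exp (q ^ 2 * v / 2)) * ∫⁻ z, f (X z) ∂ν

variable {β α : Type*} [MeasurableSpace β] [MeasurableSpace α] {ν : Measure β}
  {X : β → α} {r : β → ℝ} {v : ℝ}

/-- An exponent taking countably many values is constant on each piece `{k = j}`; the hypothesis
applies with the weight `f` cut down to that piece. -/
theorem CondSubgaussian.lintegral_int_le (h : CondSubgaussian ν X r v) (hX : Measurable X)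
    (hr : Measurable r) {f : α → ENNReal} (hf : Measurable f) {k : α → ℤ} (hk : Measurable k)
    (φ : ℤ → ℝ) :
    ∫⁻ z, f (X z) * ENNReal.ofReal (Real.exp (φ (k (X z)) * r z)) ∂ν ≤
      ∫⁻ z, f (X z) * ENNReal.ofReal (Real.exp (φ (k (X z)) ^ 2 * v / 2)) ∂ν := by
  have hφ : Measurable φ := measurable_of_countable φ
  let I : ℤ → α → ENNReal := fun j => Set.indicator (k ⁻¹' {j}) f
  have hI : ∀ j, Measurable (I j) := fun j => hf.indicator (hk (measurableSet_singleton j))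
  have hsum : ∀ (x : α) (G : ℤ → ENNReal), f x * G (k x) = ∑' j, I j x * G j := by
    intro x G
    rw [tsum_eq_single (k x)]
    · simp [I]
    · intro j hj
      have : x ∉ k ⁻¹' {j} := fun hx => hj (by simpa using hx.symm)
      simp [I, Set.indicator_of_notMem this]
  have e1 : ∀ z, f (X z) * ENNReal.ofReal (Real.exp (φ (k (X z)) * r z)) =
      ∑' j, I j (X z) * ENNReal.ofReal (Real.exp (φ j * r z)) := fun z =>
    hsum (X z) fun j => ENNReal.ofReal (Real.exp (φ j * r z))
  have e2 : ∀ z, f (X z) * ENNReal.ofReal (Real.exp (φ (k (X z)) ^ 2 * v / 2)) =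
      ∑' j, I j (X z) * ENNReal.ofReal (Real.exp (φ j ^ 2 * v / 2)) := fun z =>
    hsum (X z) fun j => ENNReal.ofReal (Real.exp (φ j ^ 2 * v / 2))
  simp only [e1, e2]
  have hIX : ∀ j, Measurable fun z => I j (X z) := fun j => (hI j).comp hX
  rw [lintegral_tsum fun j => Measurable.aemeasurable (by fun_prop),
    lintegral_tsum fun j => Measurable.aemeasurable (by fun_prop)]
  refine ENNReal.tsum_le_tsum fun j => ?_
  refine (h (φ j) (I j) (hI j)).trans_eq ?_
  rw [lintegral_mul_const _ (hIX j), mul_comm]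

/-- Rounding towards zero to a multiple of `1 / m`. -/
def roundInt (m : ℕ) (x : ℝ) : ℤ := if 0 ≤ x then ⌊m * x⌋ else ⌈m * x⌉

theorem measurable_roundInt (m : ℕ) : Measurable (roundInt m) :=
  Measurable.ite measurableSet_Ici (by fun_prop) (by fun_prop)

theorem abs_roundInt_le {m : ℕ} (hm : 0 < m) (x : ℝ) : |(roundInt m x : ℝ) / m| ≤ |x| := by
  have hm' : (0 : ℝ) < m := Nat.cast_pos.2 hm
  rw [abs_div, abs_of_pos hm', div_le_iff₀ hm', roundInt]
  split_ifs with hx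
  · have h0 : (0 : ℝ) ≤ ⌊(m : ℝ) * x⌋ := by
      exact_mod_cast Int.floor_nonneg.2 (by positivity)
    rw [abs_of_nonneg h0, abs_of_nonneg hx, mul_comm]
    exact Int.floor_le _
  · push Not at hx
    have h0 : (⌈(m : ℝ) * x⌉ : ℝ) ≤ 0 := by
      have : ⌈(m : ℝ) * x⌉ ≤ 0 := Int.ceil_le.2 (by
        push_cast
        exact mul_nonpos_of_nonneg_of_nonpos hm'.le hx.le)
      exact_mod_cast this
    rw [abs_of_nonpos h0, abs_of_neg hx]
    have := Int.le_ceil ((m : ℝ) * x)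
    linarith

theorem tendsto_roundInt (x : ℝ) :
    Filter.Tendsto (fun m : ℕ => (roundInt m x : ℝ) / m) Filter.atTop (nhds x) := by
  have hbd : ∀ m : ℕ, |(roundInt m x : ℝ) - m * x| ≤ 1 := by
    intro m
    rw [roundInt, abs_le]
    split_ifs with hx
    · have h1 := Int.floor_le ((m : ℝ) * x)
      have h2 := Int.lt_floor_add_one ((m : ℝ) * x)
      constructor <;> linarith
    · have h1 := Int.le_ceil ((m : ℝ) * x)
      have h2 := Int.ceil_lt_add_one ((m : ℝ) * x)
      constructor <;> linarith
  rw [tendsto_iff_norm_sub_tendsto_zero]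
  refine squeeze_zero' (Filter.Eventually.of_forall fun _ => norm_nonneg _) ?_
    tendsto_one_div_atTop_nhds_zero_nat
  filter_upwards [Filter.eventually_gt_atTop 0] with m hm
  have hm' : (0 : ℝ) < m := Nat.cast_pos.2 hm
  have e : (roundInt m x : ℝ) / m - x = ((roundInt m x : ℝ) - m * x) / m := by field_simp
  rw [e, Real.norm_eq_abs, abs_div, abs_of_pos hm']
  gcongr
  exact hbd m

/-- The exponent may depend measurably on `X`. -/
theorem CondSubgaussian.lintegral_le (h : CondSubgaussian ν X r v) (hv : 0 ≤ v)
    (hX : Measurable X) (hr : Measurable r) {f : α → ENNReal} (hf : Measurable f) {t : α → ℝ}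
    (ht : Measurable t) :
    ∫⁻ z, f (X z) * ENNReal.ofReal (Real.exp (t (X z) * r z)) ∂ν ≤
      ∫⁻ z, f (X z) * ENNReal.ofReal (Real.exp (t (X z) ^ 2 * v / 2)) ∂ν := by
  -- The exponent is approximated by multiples of `1 / m`, and Fatou's lemma passes to the limit.
  -- Rounding towards zero never increases `t²`, so the right-hand side needs no limit.
  let F : ℕ → β → ENNReal := fun m z =>
    f (X z) * ENNReal.ofReal (Real.exp ((roundInt m (t (X z)) : ℝ) / m * r z))
  have hFm : ∀ m, Measurable (F m) := fun m => by
    have h1 : Measurable fun z => roundInt m (t (X z)) :=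
      (measurable_roundInt m).comp (ht.comp hX)
    have h2 : Measurable fun z => ((roundInt m (t (X z)) : ℤ) : ℝ) :=
      (measurable_of_countable (fun j : ℤ => (j : ℝ))).comp h1
    exact (hf.comp hX).mul (by fun_prop)
  have hlim : ∀ z, Filter.Tendsto (fun m => F m z) Filter.atTop
      (nhds (f (X z) * ENNReal.ofReal (Real.exp (t (X z) * r z)))) := by
    intro z
    -- `f` may be infinite; multiplication is still continuous here because the limit of the other
    -- factor is not zero.
    refine ENNReal.Tendsto.const_mul ?_ (Or.inl ?_)
    · refine ENNReal.tendsto_ofReal ?_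
      exact (Real.continuous_exp.tendsto _).comp ((tendsto_roundInt (t (X z))).mul_const _)
    · simpa using Real.exp_pos _
  calc ∫⁻ z, f (X z) * ENNReal.ofReal (Real.exp (t (X z) * r z)) ∂ν
      = ∫⁻ z, Filter.liminf (fun m => F m z) Filter.atTop ∂ν :=
        lintegral_congr fun z => (hlim z).liminf_eq.symm
    _ ≤ Filter.liminf (fun m => ∫⁻ z, F m z ∂ν) Filter.atTop := lintegral_liminf_le hFm
    _ ≤ _ := by
        refine Filter.liminf_le_of_frequently_le' (Filter.Eventually.frequently ?_)
        filter_upwards [Filter.eventually_gt_atTop 0] with m hm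
        refine (h.lintegral_int_le hX hr hf ((measurable_roundInt m).comp ht)
          (fun j => (j : ℝ) / m)).trans ?_
        refine lintegral_mono fun z => ?_
        have := abs_roundInt_le hm (t (X z))
        simp only [Function.comp_apply]
        gcongr f (X z) * ENNReal.ofReal (Real.exp (?_ * v / 2))
        exact sq_le_sq.2 this

/-- Tensorization over independent copies: the exponents may depend on all the covariates. -/
theorem CondSubgaussian.lintegral_pi_le [SigmaFinite ν] (h : CondSubgaussian ν X r v) (hv : 0 ≤ v)
    (hX : Measurable X) (hr : Measurable r) (n : ℕ) :
    ∀ {F : (Fin n → α) → ENNReal} (_ : Measurable F) {T : Fin n → (Fin n → α) → ℝ}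
      (_ : ∀ i, Measurable (T i)),
    ∫⁻ z, F (fun i => X (z i)) *
        ENNReal.ofReal (Real.exp (∑ i, T i (fun j => X (z j)) * r (z i)))
        ∂Measure.pi (fun _ : Fin n => ν) ≤
      ∫⁻ z, F (fun i => X (z i)) *
        ENNReal.ofReal (Real.exp (∑ i, T i (fun j => X (z j)) ^ 2 * v / 2))
        ∂Measure.pi (fun _ : Fin n => ν) := by
  induction n with
  | zero =>
    intro F hF T hT
    simp
  | succ n ih =>
    intro F hF T hT
    have hXn : ∀ k : ℕ, Measurable fun (z : Fin k → β) (i : Fin k) => X (z i) := fun k =>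
      measurable_pi_iff.2 fun i => hX.comp (measurable_pi_apply i)
    have hFz := hF.comp (hXn (n + 1))
    have hTz : ∀ i, Measurable fun z : Fin (n + 1) → β => T i fun j => X (z j) := fun i =>
      (hT i).comp (hXn (n + 1))
    have hcons : ∀ (x : β) (y : Fin n → β),
        (fun i => X ((Fin.cons x y : Fin (n + 1) → β) i)) =
          (Fin.cons (X x) fun i => X (y i) : Fin (n + 1) → α) := by
      intro x y
      funext i
      refine Fin.cases ?_ (fun j => ?_) i <;> simp
    have hXc : Measurable fun p : β × (Fin n → β) =>
        (Fin.cons (X p.1) fun i => X (p.2 i) : Fin (n + 1) → α) :=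
      measurable_fin_cons.comp ((hX.comp measurable_fst).prodMk ((hXn n).comp measurable_snd))
    have hα1 : ∀ x : α, Measurable fun y : Fin n → α => (Fin.cons x y : Fin (n + 1) → α) := fun x =>
      measurable_fin_cons.comp measurable_prodMk_left
    have hα2 : ∀ y : Fin n → α, Measurable fun x : α => (Fin.cons x y : Fin (n + 1) → α) := fun y =>
      measurable_fin_cons.comp measurable_prodMk_right
    have hFc := hF.comp hXc
    have hTc : ∀ i, Measurable fun p : β × (Fin n → β) =>
        T i (Fin.cons (X p.1) fun j => X (p.2 j)) := fun i => (hT i).comp hXc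
    simp only [Function.comp_def] at hFz hFc
    rw [lintegral_pi_succ ν (by fun_prop), lintegral_pi_succ ν (by fun_prop)]
    simp only [hcons, Fin.sum_univ_succ, Fin.cons_zero, Fin.cons_succ, Real.exp_add,
      ENNReal.ofReal_mul (Real.exp_pos _).le]
    -- With the first sample `x` fixed, `exp(T 0 · r x)` depends on the other samples only through
    -- their covariates, so the induction hypothesis absorbs it into the weight.
    calc _ ≤ ∫⁻ x, ∫⁻ y, F (Fin.cons (X x) fun i => X (y i)) *
            ENNReal.ofReal (Real.exp (T 0 (Fin.cons (X x) fun i => X (y i)) * r x)) *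
            ENNReal.ofReal (Real.exp (∑ i : Fin n,
              T i.succ (Fin.cons (X x) fun j => X (y j)) ^ 2 * v / 2))
            ∂Measure.pi (fun _ : Fin n => ν) ∂ν := by
          refine lintegral_mono fun x => ?_
          have hx := ih (F := fun y' => F (Fin.cons (X x) y') *
              ENNReal.ofReal (Real.exp (T 0 (Fin.cons (X x) y') * r x)))
            ((hF.comp (hα1 (X x))).mul
              (by have := (hT 0).comp (hα1 (X x)); simp only [Function.comp_def] at this; fun_prop))
            (T := fun i y' => T i.succ (Fin.cons (X x) y'))
            (fun i => (hT i.succ).comp (hα1 (X x)))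
          refine le_trans (le_of_eq ?_) hx
          refine lintegral_congr fun y => ?_
          rw [mul_assoc]
      -- The remaining exponent `T 0` involves all covariates. After swapping the integrals the
      -- other samples are fixed, and it becomes a function of `X x` alone.
      _ = ∫⁻ y, ∫⁻ x, F (Fin.cons (X x) fun i => X (y i)) *
            ENNReal.ofReal (Real.exp (T 0 (Fin.cons (X x) fun i => X (y i)) * r x)) *
            ENNReal.ofReal (Real.exp (∑ i : Fin n,
              T i.succ (Fin.cons (X x) fun j => X (y j)) ^ 2 * v / 2))
            ∂ν ∂Measure.pi (fun _ : Fin n => ν) := by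
          refine lintegral_lintegral_swap (Measurable.aemeasurable ?_)
          exact (hFc.mul (by fun_prop)).mul (by fun_prop)
      _ ≤ ∫⁻ y, ∫⁻ x, F (Fin.cons (X x) fun i => X (y i)) *
            ENNReal.ofReal (Real.exp (∑ i : Fin n,
              T i.succ (Fin.cons (X x) fun j => X (y j)) ^ 2 * v / 2)) *
            ENNReal.ofReal (Real.exp (T 0 (Fin.cons (X x) fun i => X (y i)) ^ 2 * v / 2))
            ∂ν ∂Measure.pi (fun _ : Fin n => ν) := by
          refine lintegral_mono fun y => ?_
          set y' : Fin n → α := fun i => X (y i)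
          have hTy : ∀ i, Measurable fun x => T i (Fin.cons x y') := fun i =>
            (hT i).comp (hα2 y')
          have hx := h.lintegral_le hv hX hr (f := fun x => F (Fin.cons x y') *
              ENNReal.ofReal (Real.exp (∑ i : Fin n, T i.succ (Fin.cons x y') ^ 2 * v / 2)))
            ((hF.comp (hα2 y')).mul (by fun_prop)) (hTy 0)
          refine le_trans (le_of_eq ?_) hx
          refine lintegral_congr fun x => ?_
          ring
      _ = ∫⁻ x, ∫⁻ y, F (Fin.cons (X x) fun i => X (y i)) *
            ENNReal.ofReal (Real.exp (∑ i : Fin n,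
              T i.succ (Fin.cons (X x) fun j => X (y j)) ^ 2 * v / 2)) *
            ENNReal.ofReal (Real.exp (T 0 (Fin.cons (X x) fun i => X (y i)) ^ 2 * v / 2))
            ∂Measure.pi (fun _ : Fin n => ν) ∂ν := by
          refine lintegral_lintegral_swap (Measurable.aemeasurable ?_)
          have hm : Measurable fun p : β × (Fin n → β) =>
              F (Fin.cons (X p.1) fun i => X (p.2 i)) *
              ENNReal.ofReal (Real.exp (∑ i : Fin n,
                T i.succ (Fin.cons (X p.1) fun j => X (p.2 j)) ^ 2 * v / 2)) *
              ENNReal.ofReal (Real.exp (T 0 (Fin.cons (X p.1) fun i => X (p.2 i)) ^ 2 * v / 2)) :=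
            (hFc.mul (by fun_prop)).mul (by fun_prop)
          exact hm.comp measurable_swap
      _ = _ := by
          refine lintegral_congr fun x => lintegral_congr fun y => ?_
          ring

end ConditionalSubgaussian

/-! ### In-sample error by a Gaussian mixture -/

section GaussianMixture

variable {d n : ℕ}

/-- The integral of the Gaussian weight `exp (-½ ∑ᵢ ⟪h, xᵢ⟫²)` attached to a design. -/
def gaussMass (x : Fin n → Vec d) : ENNReal :=
  ∫⁻ h : Vec d, ENNReal.ofReal (Real.exp (-(∑ i, inner ℝ h (x i) ^ 2) / 2))

theorem measurable_gaussWeight (c : ℝ) : Measurable fun p : (Fin n → Vec d) × Vec d =>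
    ENNReal.ofReal (Real.exp (-(c * ∑ i, inner ℝ p.2 (p.1 i) ^ 2) / 2)) := by
  apply ENNReal.measurable_ofReal.comp
  apply Continuous.measurable
  fun_prop

theorem measurable_gaussMass : Measurable (gaussMass : (Fin n → Vec d) → ENNReal) := by
  have := (measurable_gaussWeight (d := d) (n := n) 1).lintegral_prod_right' (ν := volume)
  simp only [one_mul] at this
  exact this

theorem gaussMass_ne_zero (x : Fin n → Vec d) : gaussMass x ≠ 0 := by
  rw [gaussMass, Ne, lintegral_eq_zero_iff (by
    have := (measurable_gaussWeight (d := d) (n := n) 1).comp (measurable_prodMk_left (x := x))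
    simpa only [one_mul, Function.comp_def] using this)]
  intro h
  have h1 : ∀ᵐ y : Vec d, False := by
    filter_upwards [h] with y hy
    have := Real.exp_pos (-(∑ i, inner ℝ y (x i) ^ 2) / 2)
    simp only [Pi.zero_apply, ENNReal.ofReal_eq_zero] at hy
    linarith
  have h2 : (volume : Measure (Vec d)) Set.univ = 0 := by
    have := ae_iff.1 h1
    simpa using this
  exact (NeZero.ne _) (Measure.measure_univ_eq_zero.1 h2)

/-- Substitution `h ↦ √c • h`, with Jacobian `(√c)^d`. -/
theorem lintegral_gaussWeight_smul (x : Fin n → Vec d) {c : ℝ} (hc : 0 < c) :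
    ∫⁻ h : Vec d, ENNReal.ofReal (Real.exp (-(c * ∑ i, inner ℝ h (x i) ^ 2) / 2)) =
      ENNReal.ofReal ((Real.sqrt c ^ d)⁻¹) * gaussMass x := by
  have hR : Real.sqrt c ≠ 0 := (Real.sqrt_pos.2 hc).ne'
  have hm : Measurable fun h : Vec d =>
      ENNReal.ofReal (Real.exp (-(∑ i, inner ℝ h (x i) ^ 2) / 2)) := by
    have := (measurable_gaussWeight (d := d) (n := n) 1).comp (measurable_prodMk_left (x := x))
    simpa only [one_mul, Function.comp_def] using this
  have h1 := lintegral_map (μ := (volume : Measure (Vec d))) hm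
    (measurable_const_smul (Real.sqrt c) (α := Vec d))
  rw [Measure.map_addHaar_smul _ hR, lintegral_smul_measure, smul_eq_mul] at h1
  rw [gaussMass]
  have hfin : Module.finrank ℝ (Vec d) = d := by simp
  rw [hfin, abs_of_nonneg (by positivity)] at h1
  rw [h1]
  refine lintegral_congr fun h => ?_
  congr 4
  rw [Finset.mul_sum]
  refine Finset.sum_congr rfl fun i _ => ?_
  rw [inner_smul_left, conj_trivial, mul_pow, Real.sq_sqrt hc.le]

/-- Complete the square: by the normal equations `hb` the linear term is the inner product with `κ •
b` in the form of the design, and Lebesgue measure is invariant under translation by `κ • b`. -/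
theorem lintegral_gaussWeight_shift (x : Fin n → Vec d) (r : Fin n → ℝ) (b : Vec d)
    (hb : ∀ h, ∑ i, inner ℝ h (x i) * inner ℝ b (x i) = ∑ i, r i * inner ℝ h (x i)) (κ : ℝ) :
    ∫⁻ h : Vec d, ENNReal.ofReal (Real.exp (-(∑ i, inner ℝ h (x i) ^ 2) / 2)) *
        ENNReal.ofReal (Real.exp (∑ i, κ * inner ℝ h (x i) * r i)) =
      ENNReal.ofReal (Real.exp (κ ^ 2 * (∑ i, inner ℝ b (x i) ^ 2) / 2)) * gaussMass x := by
  have hshift : gaussMass x = ∫⁻ h : Vec d,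
      ENNReal.ofReal (Real.exp (-(∑ i, inner ℝ (h - κ • b) (x i) ^ 2) / 2)) :=
    (lintegral_sub_right_eq_self (fun h : Vec d =>
      ENNReal.ofReal (Real.exp (-(∑ i, inner ℝ h (x i) ^ 2) / 2))) (κ • b)).symm
  rw [hshift, ← lintegral_const_mul' _ _ ENNReal.ofReal_ne_top]
  refine lintegral_congr fun h => ?_
  rw [← ENNReal.ofReal_mul (Real.exp_pos _).le, ← ENNReal.ofReal_mul (Real.exp_pos _).le,
    ← Real.exp_add, ← Real.exp_add]
  congr 2
  have e1 : ∑ i, κ * inner ℝ h (x i) * r i = κ * ∑ i, inner ℝ h (x i) * inner ℝ b (x i) := by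
    rw [hb, Finset.mul_sum]
    exact Finset.sum_congr rfl fun i _ => by ring
  have e2 : ∑ i, inner ℝ (h - κ • b) (x i) ^ 2 = ∑ i, inner ℝ h (x i) ^ 2
      - 2 * κ * (∑ i, inner ℝ h (x i) * inner ℝ b (x i)) + κ ^ 2 * ∑ i, inner ℝ b (x i) ^ 2 := by
    rw [Finset.mul_sum, Finset.mul_sum, ← Finset.sum_sub_distrib, ← Finset.sum_add_distrib]
    refine Finset.sum_congr rfl fun i _ => ?_
    rw [inner_sub_left, inner_smul_left, conj_trivial]
    ring
  rw [e1, e2]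
  ring

/-- The Gaussian mass is finite for a nondegenerate design. -/
theorem gaussMass_ne_top (x : Fin n → Vec d) {c : ℝ} (hc : 0 < c)
    (hx : ∀ h : Vec d, c * ‖h‖ ^ 2 ≤ ∑ i, inner ℝ h (x i) ^ 2) : gaussMass x ≠ ⊤ := by
  have h1 : Integrable fun h : Vec d => Real.exp (-(c / 2) * ‖h‖ ^ 2) := by
    have h2 := GaussianFourier.integrable_cexp_neg_mul_sq_norm_add (V := Vec d)
      (b := ((c / 2 : ℝ) : ℂ)) (by simpa using half_pos hc) 0 0
    have h3 := h2.norm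
    refine h3.congr (Filter.Eventually.of_forall fun h => ?_)
    simp only [Complex.norm_exp]
    congr 1
    simp [← Complex.ofReal_pow]
  refine ne_top_of_le_ne_top h1.lintegral_lt_top.ne ?_
  refine lintegral_mono fun h => ENNReal.ofReal_le_ofReal (Real.exp_le_exp.2 ?_)
  linarith [hx h]

variable {β : Type*} [MeasurableSpace β] {ν : Measure β} [IsProbabilityMeasure ν]
  {X : β → Vec d} {r : β → ℝ} {σ : ℝ}

/-- The tensorized bound, integrated over a direction `h`. -/
theorem CondSubgaussian.lintegral_mixture_le {v : ℝ} (h : CondSubgaussian ν X r v) (hv : 0 ≤ v)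
    (hX : Measurable X) (hr : Measurable r) (κ : ℝ) {G : (Fin n → Vec d) → Vec d → ENNReal}
    (hG : Measurable fun p : (Fin n → Vec d) × Vec d => G p.1 p.2) :
    ∫⁻ z, (∫⁻ y : Vec d, G (fun i => X (z i)) y *
        ENNReal.ofReal (Real.exp (∑ i, κ * inner ℝ y (X (z i)) * r (z i))))
        ∂Measure.pi (fun _ : Fin n => ν) ≤
      ∫⁻ z, (∫⁻ y : Vec d, G (fun i => X (z i)) y *
        ENNReal.ofReal (Real.exp (∑ i, (κ * inner ℝ y (X (z i))) ^ 2 * v / 2)))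
        ∂Measure.pi (fun _ : Fin n => ν) := by
  have hXn : Measurable fun (z : Fin n → β) (i : Fin n) => X (z i) :=
    measurable_pi_iff.2 fun i => hX.comp (measurable_pi_apply i)
  have hGz : Measurable fun p : (Fin n → β) × Vec d => G (fun i => X (p.1 i)) p.2 :=
    hG.comp ((hXn.comp measurable_fst).prodMk measurable_snd)
  have hin : ∀ i, Measurable fun p : (Fin n → β) × Vec d => inner ℝ p.2 (X (p.1 i)) := fun i =>
    measurable_snd.inner (hX.comp ((measurable_pi_apply i).comp measurable_fst))
  have hri : ∀ i, Measurable fun p : (Fin n → β) × Vec d => r (p.1 i) := fun i =>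
    hr.comp ((measurable_pi_apply i).comp measurable_fst)
  have h1 : Measurable fun p : (Fin n → β) × Vec d => G (fun i => X (p.1 i)) p.2 *
      ENNReal.ofReal (Real.exp (∑ i, κ * inner ℝ p.2 (X (p.1 i)) * r (p.1 i))) :=
    hGz.mul (ENNReal.measurable_ofReal.comp (Real.measurable_exp.comp
      (Finset.measurable_fun_sum _ fun i _ => ((hin i).const_mul κ).mul (hri i))))
  have h2 : Measurable fun p : (Fin n → β) × Vec d => G (fun i => X (p.1 i)) p.2 *
      ENNReal.ofReal (Real.exp (∑ i, (κ * inner ℝ p.2 (X (p.1 i))) ^ 2 * v / 2)) :=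
    hGz.mul (ENNReal.measurable_ofReal.comp (Real.measurable_exp.comp
      (Finset.measurable_fun_sum _ fun i _ =>
        ((((hin i).const_mul κ).pow_const 2).mul_const v).div_const 2)))
  refine (lintegral_lintegral_swap h1.aemeasurable).trans_le
    (le_trans (lintegral_mono fun y => ?_) (lintegral_lintegral_swap h2.aemeasurable).symm.le)
  have hT : ∀ i : Fin n, Measurable fun x : Fin n → Vec d => κ * inner ℝ y (x i) := fun i =>
    (measurable_const.inner (measurable_pi_apply i)).const_mul κ
  exact h.lintegral_pi_le hv hX hr n (F := fun x => G x y) (hG.comp measurable_prodMk_right)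
    (T := fun i x => κ * inner ℝ y (x i)) hT

/-- Exponential moment of the in-sample squared error, conditionally subgaussian noise. -/
theorem CondSubgaussian.measure_quadratic_gt_le (h : CondSubgaussian ν X r (σ ^ 2))
    (hX : Measurable X) (hr : Measurable r) {s : ℝ} (hs : 0 ≤ s) (hs1 : 2 * s * σ ^ 2 < 1)
    (c : ℝ) :
    Measure.pi (fun _ : Fin n => ν) {z | gaussMass (fun i => X (z i)) ≠ ⊤ ∧
        ∃ b : Vec d, (∀ h, ∑ i, inner ℝ h (X (z i)) * inner ℝ b (X (z i)) =
          ∑ i, r (z i) * inner ℝ h (X (z i))) ∧ c < ∑ i, inner ℝ b (X (z i)) ^ 2} ≤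
      ENNReal.ofReal (Real.exp (-(s * c)) * (Real.sqrt (1 - 2 * s * σ ^ 2) ^ d)⁻¹) := by
  -- With this `κ`, the shifted Gaussian integral yields `exp(κ² Q(b) / 2) = exp(s Q(b))`.
  set κ : ℝ := Real.sqrt (2 * s) with hκ
  have hκ2 : κ ^ 2 = 2 * s := Real.sq_sqrt (by positivity)
  have hXn : Measurable fun (z : Fin n → β) (i : Fin n) => X (z i) :=
    measurable_pi_iff.2 fun i => hX.comp (measurable_pi_apply i)
  -- Normalising weight, set to zero when the mass is infinite, so that `g x * gaussMass x ≤ 1` for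
  -- every design and equality holds on the event considered.
  set g : (Fin n → Vec d) → ENNReal := fun x => {x | gaussMass x ≠ ⊤}.indicator
    (fun x => (gaussMass x)⁻¹) x with hg
  have hgm : Measurable g :=
    measurable_gaussMass.inv.indicator
      (measurable_gaussMass (measurableSet_singleton _).compl)
  have hgtop : ∀ x, g x ≠ ⊤ := by
    intro x
    simp only [hg, Set.indicator_apply]
    split_ifs
    · exact ENNReal.inv_ne_top.2 (gaussMass_ne_zero x)
    · exact ENNReal.zero_ne_top
  have hgmul : ∀ x, g x * gaussMass x ≤ 1 := by
    intro x
    simp only [hg, Set.indicator_apply]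
    split_ifs with hx
    · exact (ENNReal.inv_mul_cancel (gaussMass_ne_zero x) hx).le
    · simp
  set w : (Fin n → Vec d) → Vec d → ENNReal := fun x h =>
    ENNReal.ofReal (Real.exp (-(∑ i, inner ℝ h (x i) ^ 2) / 2)) with hw
  have hwm : Measurable fun p : (Fin n → Vec d) × Vec d => w p.1 p.2 := by
    have := measurable_gaussWeight (d := d) (n := n) 1
    simpa only [one_mul] using this
  set J : (Fin n → β) → ENNReal := fun z => ∫⁻ h : Vec d, g (fun i => X (z i)) *
    w (fun i => X (z i)) h *
    ENNReal.ofReal (Real.exp (∑ i, κ * inner ℝ h (X (z i)) * r (z i))) with hJ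
  have hGm : Measurable fun p : (Fin n → Vec d) × Vec d => g p.1 * w p.1 p.2 :=
    (hgm.comp measurable_fst).mul hwm
  have hin : ∀ i, Measurable fun p : (Fin n → β) × Vec d => inner ℝ p.2 (X (p.1 i)) := fun i =>
    measurable_snd.inner (hX.comp ((measurable_pi_apply i).comp measurable_fst))
  have hri : ∀ i, Measurable fun p : (Fin n → β) × Vec d => r (p.1 i) := fun i =>
    hr.comp ((measurable_pi_apply i).comp measurable_fst)
  have hsqInt : Measurable fun p : (Fin n → β) × Vec d => g (fun i => X (p.1 i)) *
      w (fun i => X (p.1 i)) p.2 *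
      ENNReal.ofReal (Real.exp (∑ i, κ * inner ℝ p.2 (X (p.1 i)) * r (p.1 i))) :=
    (hGm.comp ((hXn.comp measurable_fst).prodMk measurable_snd)).mul
      (ENNReal.measurable_ofReal.comp (Real.measurable_exp.comp
        (Finset.measurable_fun_sum _ fun i _ => ((hin i).const_mul κ).mul (hri i))))
  have hJm : Measurable J := hsqInt.lintegral_prod_right' (ν := volume)
  have hJint : ∫⁻ z, J z ∂Measure.pi (fun _ : Fin n => ν) ≤
      ENNReal.ofReal ((Real.sqrt (1 - 2 * s * σ ^ 2) ^ d)⁻¹) := by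
    calc ∫⁻ z, J z ∂Measure.pi (fun _ : Fin n => ν)
        ≤ ∫⁻ z, (∫⁻ y : Vec d, g (fun i => X (z i)) * w (fun i => X (z i)) y *
            ENNReal.ofReal (Real.exp (∑ i, (κ * inner ℝ y (X (z i))) ^ 2 * σ ^ 2 / 2)))
            ∂Measure.pi (fun _ : Fin n => ν) :=
          h.lintegral_mixture_le (sq_nonneg σ) hX hr κ (G := fun x y => g x * w x y) hGm
      _ ≤ ∫⁻ _z, ENNReal.ofReal ((Real.sqrt (1 - 2 * s * σ ^ 2) ^ d)⁻¹)
            ∂Measure.pi (fun _ : Fin n => ν) := by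
          refine lintegral_mono fun z => ?_
          set x : Fin n → Vec d := fun i => X (z i) with hx
          have e : ∀ y : Vec d, g x * w x y * ENNReal.ofReal (Real.exp
              (∑ i, (κ * inner ℝ y (X (z i))) ^ 2 * σ ^ 2 / 2)) = g x * ENNReal.ofReal
              (Real.exp (-((1 - 2 * s * σ ^ 2) * ∑ i, inner ℝ y (x i) ^ 2) / 2)) := by
            intro y
            rw [mul_assoc, hw, ← ENNReal.ofReal_mul (Real.exp_pos _).le, ← Real.exp_add]
            congr 3
            have : ∑ i, (κ * inner ℝ y (X (z i))) ^ 2 * σ ^ 2 / 2 =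
                s * σ ^ 2 * ∑ i, inner ℝ y (x i) ^ 2 := by
              rw [Finset.mul_sum]
              refine Finset.sum_congr rfl fun i _ => ?_
              rw [mul_pow, hκ2]
              ring
            rw [this]
            ring
          simp only [e]
          rw [lintegral_const_mul' _ _ (hgtop x), lintegral_gaussWeight_smul x (by linarith),
            mul_left_comm]
          exact mul_le_of_le_one_right' (hgmul x)
      _ = _ := by simp
  set a : ℝ := Real.exp (s * c)
  have ha0 : 0 < a := Real.exp_pos _
  refine (measure_mono (t := {z | ENNReal.ofReal a ≤ J z}) ?_).trans ?_
  · rintro z ⟨hz, b, hb, hcb⟩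
    set x : Fin n → Vec d := fun i => X (z i) with hx
    have hJz : J z = ENNReal.ofReal (Real.exp (κ ^ 2 * (∑ i, inner ℝ b (x i) ^ 2) / 2)) := by
      have hJz' : J z = ∫⁻ y : Vec d, g x * (w x y *
          ENNReal.ofReal (Real.exp (∑ i, κ * inner ℝ y (x i) * r (z i)))) :=
        lintegral_congr fun y => mul_assoc _ _ _
      rw [hJz', lintegral_const_mul' _ _ (hgtop x), lintegral_gaussWeight_shift x (fun i => r (z i)) b hb,
        mul_left_comm]
      have : g x * gaussMass x = 1 := by
        simp only [hg]
        rw [Set.indicator_of_mem (by exact hz)]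
        exact ENNReal.inv_mul_cancel (gaussMass_ne_zero x) hz
      rw [this, mul_one]
    simp only [Set.mem_ofPred_eq]
    rw [hJz, hκ2]
    refine ENNReal.ofReal_le_ofReal (Real.exp_le_exp.2 ?_)
    have := mul_le_mul_of_nonneg_left hcb.le hs
    simp only [hx]
    linarith
  · refine (meas_ge_le_lintegral_div hJm.aemeasurable (by simpa using ha0)
      ENNReal.ofReal_ne_top).trans ?_
    refine (ENNReal.div_le_div_right hJint _).trans_eq ?_
    rw [← ENNReal.ofReal_div_of_pos ha0, Real.exp_neg]
    congr 1
    rw [div_eq_mul_inv, mul_comm]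

/-- Fixed design tail bound for the in-sample squared error of least squares. -/
theorem CondSubgaussian.measure_quadratic_gt_le_exp (h : CondSubgaussian ν X r (σ ^ 2))
    (hX : Measurable X) (hr : Measurable r) {t : ℝ} (ht : 0 ≤ t) :
    Measure.pi (fun _ : Fin n => ν) {z | gaussMass (fun i => X (z i)) ≠ ⊤ ∧
        ∃ b : Vec d, (∀ h, ∑ i, inner ℝ h (X (z i)) * inner ℝ b (X (z i)) =
          ∑ i, r (z i) * inner ℝ h (X (z i))) ∧
        σ ^ 2 * (d + 2 * Real.sqrt (d * t) + 2 * t) < ∑ i, inner ℝ b (X (z i)) ^ 2} ≤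
      ENNReal.ofReal (Real.exp (-t)) := by
  rcases Nat.eq_zero_or_pos d with rfl | hd
  · have : {z : Fin n → β | gaussMass (fun i => X (z i)) ≠ ⊤ ∧
        ∃ b : Vec 0, (∀ h, ∑ i, inner ℝ h (X (z i)) * inner ℝ b (X (z i)) =
          ∑ i, r (z i) * inner ℝ h (X (z i))) ∧
        σ ^ 2 * ((0 : ℕ) + 2 * Real.sqrt ((0 : ℕ) * t) + 2 * t) <
          ∑ i, inner ℝ b (X (z i)) ^ 2} = ∅ := by
      refine Set.eq_empty_of_forall_notMem fun z hz => ?_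
      obtain ⟨-, b, -, hlt⟩ := hz
      have hb : b = 0 := Subsingleton.elim _ _
      rw [hb] at hlt
      simp at hlt
      have : 0 ≤ σ ^ 2 * (2 * t) := by positivity
      linarith
    rw [this]
    simp
  have hd' : (0 : ℝ) < d := Nat.cast_pos.2 hd
  -- Without noise every `s` is admissible: letting `s → ∞` makes each event `1/(k+1) < Q(b)` null,
  -- and these exhaust `0 < Q(b)`.
  rcases eq_or_ne σ 0 with hσ | hσ
  · have hnull : ∀ k : ℕ, Measure.pi (fun _ : Fin n => ν) {z | gaussMass (fun i => X (z i)) ≠ ⊤ ∧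
        ∃ b : Vec d, (∀ h, ∑ i, inner ℝ h (X (z i)) * inner ℝ b (X (z i)) =
          ∑ i, r (z i) * inner ℝ h (X (z i))) ∧
        1 / ((k : ℝ) + 1) < ∑ i, inner ℝ b (X (z i)) ^ 2} = 0 := by
      intro k
      have hlim : Filter.Tendsto
          (fun m : ℕ => ENNReal.ofReal (Real.exp (-((m : ℝ) * (1 / ((k : ℝ) + 1))))))
          Filter.atTop (nhds 0) := by
        rw [← ENNReal.ofReal_zero]
        refine ENNReal.tendsto_ofReal (Real.tendsto_exp_neg_atTop_nhds_zero.comp ?_)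
        exact tendsto_natCast_atTop_atTop.atTop_mul_const (by positivity)
      refine le_antisymm (ge_of_tendsto' hlim fun m => ?_) bot_le
      have := h.measure_quadratic_gt_le (n := n) hX hr (s := m) (by positivity)
        (by rw [hσ]; norm_num) (1 / ((k : ℝ) + 1))
      refine this.trans_eq ?_
      rw [hσ]
      simp
    refine le_trans (le_of_eq ?_) bot_le
    refine measure_mono_null ?_ (measure_iUnion_null hnull)
    rintro z ⟨hz, b, hb, hlt⟩
    rw [hσ] at hlt
    have hlt' : 0 < ∑ i, inner ℝ b (X (z i)) ^ 2 := by simpa using hlt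
    obtain ⟨k, hk⟩ := exists_nat_one_div_lt hlt'
    exact Set.mem_iUnion.2 ⟨k, hz, b, hb, hk⟩
  have hσ2 : 0 < σ ^ 2 := by positivity
  -- With `x = sσ²`, `-(d/2) log(1 - 2x) ≤ dx + 2d x²/(2(1 - 2x))`: mean `d`, and sub-gamma
  -- parameters `v = 2d`, `c = 2`.
  obtain ⟨x, hx0, hx1, hx⟩ := exists_subgamma_chernoff (v := 2 * (d : ℝ)) (c := 2) (s := t)
    (by positivity) (by norm_num) ht
  have hsq : Real.sqrt (2 * (2 * (d : ℝ)) * t) = 2 * Real.sqrt (d * t) := by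
    have e : 2 * (2 * (d : ℝ)) * t = 2 ^ 2 * (d * t) := by ring
    rw [e, Real.sqrt_mul (by positivity), Real.sqrt_sq (by norm_num)]
  rw [hsq] at hx
  have hxs : 2 * (x / σ ^ 2) * σ ^ 2 = 2 * x := by field_simp
  have := h.measure_quadratic_gt_le (n := n) hX hr (s := x / σ ^ 2) (by positivity)
    (by rw [hxs]; exact hx1) (σ ^ 2 * (d + 2 * Real.sqrt (d * t) + 2 * t))
  refine this.trans (ENNReal.ofReal_le_ofReal ?_)
  have hpos : 0 < 1 - 2 * x := by linarith
  rw [hxs]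
  have e1 : x / σ ^ 2 * (σ ^ 2 * (d + 2 * Real.sqrt (d * t) + 2 * t)) =
      x * (d + 2 * Real.sqrt (d * t) + 2 * t) := by field_simp
  have e2 : (Real.sqrt (1 - 2 * x) ^ d)⁻¹ = Real.exp (-(d * (Real.log (1 - 2 * x) / 2))) := by
    rw [Real.exp_neg, Real.exp_nat_mul, ← Real.log_sqrt hpos.le,
      Real.exp_log (Real.sqrt_pos.2 hpos)]
  rw [e1, e2, ← Real.exp_add]
  apply Real.exp_le_exp.2
  have h1 := neg_log_one_sub_le (y := 2 * x) (by positivity) hx1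
  have h2 : (2 * x) ^ 2 / (2 * (1 - 2 * x)) = 2 * (2 * x ^ 2 / (2 * (1 - 2 * x))) := by
    field_simp
  have h3 : 2 * (d : ℝ) * x ^ 2 / (2 * (1 - 2 * x)) = d * (2 * x ^ 2 / (2 * (1 - 2 * x))) := by
    field_simp
  rw [h2] at h1
  rw [h3] at hx
  have h4 := mul_le_mul_of_nonneg_left h1 hd'.le
  linarith

end GaussianMixture

/-! ### Matrices acting on Euclidean space -/

section MatrixAction

variable {d n : ℕ}

theorem app_mul (A B : Mat d) (x : Vec d) : app (A * B) x = app A (app B x) := by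
  simp [app]

theorem app_one (x : Vec d) : app 1 x = x := by
  simp [app]

theorem inner_app_eq_sum (A : Mat d) (x y : Vec d) :
    inner ℝ x (app A y) = ∑ i, ∑ j, x i * A i j * y j := by
  simp only [app, PiLp.inner_apply, Matrix.ofLp_toEuclideanCLM, Matrix.mulVec, dotProduct,
    RCLike.inner_apply, conj_trivial, Finset.sum_mul]
  exact Finset.sum_congr rfl fun i _ => Finset.sum_congr rfl fun j _ => by ring

theorem inner_app_left {A : Mat d} (hA : A.IsHermitian) (x y : Vec d) :
    inner ℝ (app A x) y = inner ℝ x (app A y) := by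
  rw [real_inner_comm, inner_app_eq_sum, inner_app_eq_sum, Finset.sum_comm]
  refine Finset.sum_congr rfl fun i _ => Finset.sum_congr rfl fun j _ => ?_
  have := hA.apply i j
  simp only [star_trivial] at this
  rw [this]
  ring

theorem posDef_of_inner_app_pos {A : Mat d} (hA : A.IsHermitian)
    (h : ∀ x : Vec d, x ≠ 0 → 0 < inner ℝ x (app A x)) : A.PosDef := by
  refine Matrix.PosDef.of_dotProduct_mulVec_pos hA fun x hx => ?_
  have := h (WithLp.toLp 2 x) (by simpa using hx)
  rw [inner_app_eq_sum] at this
  simpa [dotProduct, Matrix.mulVec, Finset.mul_sum, mul_assoc] using this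

theorem posSemidef_of_inner_app_nonneg {A : Mat d} (hA : A.IsHermitian)
    (h : ∀ x : Vec d, 0 ≤ inner ℝ x (app A x)) : A.PosSemidef := by
  refine Matrix.PosSemidef.of_dotProduct_mulVec_nonneg hA fun x => ?_
  have := h (WithLp.toLp 2 x)
  rw [inner_app_eq_sum] at this
  simpa [dotProduct, Matrix.mulVec, Finset.mul_sum, mul_assoc] using this

theorem inner_app_empSecondMoment (x : Fin n → Vec d) (a b : Vec d) :
    inner ℝ a (app (empSecondMoment x) b) = (∑ k, inner ℝ a (x k) * inner ℝ b (x k)) / n := by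
  rw [inner_app_eq_sum]
  simp only [empSecondMoment, Matrix.of_apply, PiLp.inner_apply, RCLike.inner_apply, conj_trivial,
    Finset.sum_div, Finset.mul_sum, Finset.sum_mul]
  rw [Finset.sum_congr rfl fun i _ => Finset.sum_comm, Finset.sum_comm]
  exact Finset.sum_congr rfl fun k _ => Finset.sum_comm.trans (Finset.sum_congr rfl fun i _ =>
    Finset.sum_congr rfl fun j _ => by ring)

theorem isHermitian_empSecondMoment (x : Fin n → Vec d) : (empSecondMoment x).IsHermitian := by
  ext i j
  simp [empSecondMoment, mul_comm]

theorem app_inv_cancel {A : Mat d} (hA : IsUnit A.det) (x : Vec d) : app A (app A⁻¹ x) = x := by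
  rw [← app_mul, Matrix.mul_nonsing_inv A hA, app_one]

theorem inv_app_cancel {A : Mat d} (hA : IsUnit A.det) (x : Vec d) : app A⁻¹ (app A x) = x := by
  rw [← app_mul, Matrix.nonsing_inv_mul A hA, app_one]

theorem norm_app_le (A : Mat d) (x : Vec d) : ‖app A x‖ ≤ specNorm A * ‖x‖ :=
  ContinuousLinearMap.le_opNorm _ _

/-- The facts used about the square root `R = S^{1/2}` of an invertible covariance. -/
structure IsInvertibleRoot (R S : Mat d) : Prop where
  isHermitian : R.IsHermitian
  mul_self : R * R = S
  isUnit_det : IsUnit R.det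

theorem IsInvertibleRoot.sqrtM {S : Mat d} (hS : S.PosSemidef) (hu : IsUnit S.det) :
    IsInvertibleRoot (RandomDesign.sqrtM S) S := by
  have h1 : RandomDesign.sqrtM S * RandomDesign.sqrtM S = S := CFC.sqrt_mul_sqrt_self S hS.nonneg
  refine ⟨(Matrix.nonneg_iff_posSemidef.1 (CFC.sqrt_nonneg S)).isHermitian, h1, ?_⟩
  have h2 := congrArg Matrix.det h1
  rw [Matrix.det_mul] at h2
  rw [← h2] at hu
  exact isUnit_of_mul_isUnit_left hu

variable {R S : Mat d}

theorem IsInvertibleRoot.inner_app_inv (hR : IsInvertibleRoot R S) (v x : Vec d) :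
    inner ℝ v (app R⁻¹ x) = inner ℝ (app R⁻¹ v) x :=
  (inner_app_left hR.isHermitian.inv v x).symm

theorem IsInvertibleRoot.inner_eq (hR : IsInvertibleRoot R S) (h x : Vec d) :
    inner ℝ h x = inner ℝ (app R h) (app R⁻¹ x) := by
  rw [inner_app_left hR.isHermitian, app_inv_cancel hR.isUnit_det]

theorem IsInvertibleRoot.inner_app_self (hR : IsInvertibleRoot R S) (h : Vec d) :
    inner ℝ h (app S h) = ‖app R h‖ ^ 2 := by
  rw [← hR.mul_self, app_mul, ← inner_app_left hR.isHermitian, real_inner_self_eq_norm_sq]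

end MatrixAction

/-! ### Deterministic consequences of a well-conditioned design -/

section Deterministic

variable {d n : ℕ} {R S : Mat d} {x : Fin n → Vec d} {κ : ℝ}

/-- The whitened design is bounded below by `κ`. -/
def DesignLowerBound (R : Mat d) (x : Fin n → Vec d) (κ : ℝ) : Prop :=
  ∀ v : Vec d, n * κ * ‖v‖ ^ 2 ≤ ∑ i, inner ℝ v (app R⁻¹ (x i)) ^ 2

theorem DesignLowerBound.le_sum (hx : DesignLowerBound R x κ) (hR : IsInvertibleRoot R S)
    (h : Vec d) : n * κ * ‖app R h‖ ^ 2 ≤ ∑ i, inner ℝ h (x i) ^ 2 := by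
  refine (hx (app R h)).trans_eq ?_
  exact Finset.sum_congr rfl fun i _ => by rw [← hR.inner_eq]

theorem DesignLowerBound.le_inner (hx : DesignLowerBound R x κ) (hR : IsInvertibleRoot R S)
    (hn : 0 < n) (h : Vec d) :
    κ * ‖app R h‖ ^ 2 ≤ inner ℝ h (app (empSecondMoment x) h) := by
  have hn' : (0 : ℝ) < n := Nat.cast_pos.2 hn
  have h1 := hx.le_sum hR h
  rw [inner_app_empSecondMoment, le_div_iff₀ hn']
  simp only [← sq]
  linarith

theorem IsInvertibleRoot.norm_app_pos (hR : IsInvertibleRoot R S) {h : Vec d} (hh : h ≠ 0) :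
    0 < ‖app R h‖ := by
  refine norm_pos_iff.2 fun h0 => hh ?_
  rw [← inv_app_cancel hR.isUnit_det h, h0]
  simp [app]

theorem DesignLowerBound.posDef (hx : DesignLowerBound R x κ) (hR : IsInvertibleRoot R S)
    (hn : 0 < n) (hκ : 0 < κ) : (empSecondMoment x).PosDef := by
  refine posDef_of_inner_app_pos (isHermitian_empSecondMoment x) fun h hh => ?_
  refine lt_of_lt_of_le ?_ (hx.le_inner hR hn h)
  have := hR.norm_app_pos hh
  positivity

/-- For `h = Σ̂⁻¹ R u`, `κ ‖R h‖² ≤ ⟪h, Σ̂ h⟫ = ⟪R h, u⟫ ≤ ‖R h‖ ‖u‖`; divide by `‖R h‖`. -/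
theorem DesignLowerBound.specNorm_le (hx : DesignLowerBound R x κ) (hR : IsInvertibleRoot R S)
    (hn : 0 < n) (hκ : 0 < κ) : specNorm (R * (empSecondMoment x)⁻¹ * R) ≤ 1 / κ := by
  have hu : IsUnit (empSecondMoment x).det := (hx.posDef hR hn hκ).det_pos.ne'.isUnit
  refine ContinuousLinearMap.opNorm_le_bound _ (by positivity) fun u => ?_
  change ‖app (R * (empSecondMoment x)⁻¹ * R) u‖ ≤ _
  rw [app_mul, app_mul]
  set h := app (empSecondMoment x)⁻¹ (app R u) with hh
  have h1 := hx.le_inner hR hn h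
  rw [hh, app_inv_cancel hu, ← hh, ← inner_app_left hR.isHermitian] at h1
  have h2 := (le_abs_self _).trans (abs_real_inner_le_norm (app R h) u)
  rcases (norm_nonneg (app R h)).eq_or_lt with h0 | h0
  · rw [← h0]
    positivity
  · have h3 : κ * ‖app R h‖ ≤ ‖u‖ := by
      refine le_of_mul_le_mul_left ?_ h0
      calc ‖app R h‖ * (κ * ‖app R h‖) = κ * ‖app R h‖ ^ 2 := by ring
        _ ≤ ‖app R h‖ * ‖u‖ := h1.trans h2
    rw [one_div, inv_mul_eq_div, le_div_iff₀ hκ]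
    linarith

theorem DesignLowerBound.mNorm_sq_le (hx : DesignLowerBound R x κ) (hR : IsInvertibleRoot R S)
    (hn : 0 < n) (hκ : 0 < κ) (b : Vec d) :
    mNorm S b ^ 2 ≤ 1 / κ * ((∑ i, inner ℝ b (x i) ^ 2) / n) := by
  have hn' : (0 : ℝ) < n := Nat.cast_pos.2 hn
  have e := hR.inner_app_self b
  rw [mNorm, Real.sq_sqrt (by rw [e]; positivity), e, one_div, inv_mul_eq_div, le_div_iff₀ hκ,
    le_div_iff₀ hn']
  linarith [hx.le_sum hR b]

/-- The noise bound is only available for designs of finite Gaussian mass; the design event provides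
this. -/
theorem DesignLowerBound.gaussMass_ne_top (hx : DesignLowerBound R x κ)
    (hR : IsInvertibleRoot R S) (hn : 0 < n) (hκ : 0 < κ) : gaussMass x ≠ ⊤ := by
  have hn' : (0 : ℝ) < n := Nat.cast_pos.2 hn
  set m : ℝ := specNorm R⁻¹ with hm
  have hm0 : 0 ≤ m := norm_nonneg _
  -- The `+ 1` avoids dividing by `m = 0`, which occurs for `d = 0`.
  refine RandomDesign.gaussMass_ne_top x (c := n * κ / (m ^ 2 + 1)) (by positivity) fun h => ?_
  refine le_trans ?_ (hx.le_sum hR h)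
  have h1 := norm_app_le R⁻¹ (app R h)
  rw [inv_app_cancel hR.isUnit_det] at h1
  have h2 : ‖h‖ ^ 2 ≤ (m ^ 2 + 1) * ‖app R h‖ ^ 2 := by
    calc ‖h‖ ^ 2 ≤ (m * ‖app R h‖) ^ 2 := by gcongr
      _ ≤ (m ^ 2 + 1) * ‖app R h‖ ^ 2 := by nlinarith [sq_nonneg ‖app R h‖]
  rw [div_mul_eq_mul_div, div_le_iff₀ (by positivity), mul_assoc (n * κ : ℝ)]
  refine mul_le_mul_of_nonneg_left ?_ (by positivity)
  linarith

/-- The normal equations for the error of ordinary least squares. -/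
theorem normal_equations (hn : 0 < n) (hu : IsUnit (empSecondMoment x).det) (y : Fin n → ℝ)
    (β h : Vec d) :
    ∑ i, inner ℝ h (x i) * inner ℝ (ols x y - β) (x i) =
      ∑ i, (y i - inner ℝ (x i) β) * inner ℝ h (x i) := by
  have hn' : (n : ℝ) ≠ 0 := (Nat.cast_pos.2 hn).ne'
  have h1 : inner ℝ h (app (empSecondMoment x) (ols x y)) =
      (∑ i, y i * inner ℝ h (x i)) / n := by
    rw [ols, app_inv_cancel hu, inner_smul_right, inner_sum, inv_mul_eq_div]
    simp only [inner_smul_right]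
  rw [inner_app_empSecondMoment, div_left_inj' hn'] at h1
  simp only [inner_sub_left, mul_sub, sub_mul, Finset.sum_sub_distrib, h1]
  congr 1
  exact Finset.sum_congr rfl fun i _ => by rw [real_inner_comm β (x i), mul_comm]

end Deterministic

/-! ### The whitened covariate and the noise law -/

section Population

variable {Ω : Type*} [MeasurableSpace Ω] {P : Measure Ω} {d : ℕ} {X : Ω → Vec d}

theorem integrable_inner_mul_inner (hX : MemLp X 2 P) (a b : Vec d) :
    Integrable (fun ω => inner ℝ a (X ω) * inner ℝ b (X ω)) P :=
  (hX.const_inner a).integrable_mul (hX.const_inner b)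

theorem inner_app_secondMoment (hX : MemLp X 2 P) (a b : Vec d) :
    inner ℝ a (app (secondMoment P X) b) = ∫ ω, inner ℝ a (X ω) * inner ℝ b (X ω) ∂P := by
  have hi : ∀ i j, Integrable (fun ω => X ω i * X ω j) P := fun i j => by
    have := integrable_inner_mul_inner hX (EuclideanSpace.single i 1) (EuclideanSpace.single j 1)
    simpa [EuclideanSpace.inner_single_left] using this
  have e : ∀ ω, inner ℝ a (X ω) * inner ℝ b (X ω) =
      ∑ i, ∑ j, a i * b j * (X ω i * X ω j) := by
    intro ω
    simp only [PiLp.inner_apply, RCLike.inner_apply, conj_trivial, Finset.sum_mul_sum]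
    exact Finset.sum_congr rfl fun i _ => Finset.sum_congr rfl fun j _ => by ring
  simp only [e]
  rw [inner_app_eq_sum, integral_finsetSum _ fun i _ =>
    integrable_finsetSum _ fun j _ => (hi i j).const_mul _]
  refine Finset.sum_congr rfl fun i _ => ?_
  rw [integral_finsetSum _ fun j _ => (hi i j).const_mul _]
  refine Finset.sum_congr rfl fun j _ => ?_
  rw [integral_const_mul, secondMoment, Matrix.of_apply]
  ring

theorem isInvertibleRoot_sqrtM_secondMoment (hX : MemLp X 2 P)
    (hu : IsUnit (secondMoment P X).det) :
    IsInvertibleRoot (sqrtM (secondMoment P X)) (secondMoment P X) := by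
  refine IsInvertibleRoot.sqrtM (posSemidef_of_inner_app_nonneg ?_ fun v => ?_) hu
  · ext i j
    simp [secondMoment, mul_comm]
  · rw [inner_app_secondMoment hX]
    exact integral_nonneg fun ω => mul_self_nonneg _

theorem measurable_app (A : Mat d) : Measurable (app A) :=
  (Matrix.toEuclideanCLM (n := Fin d) (𝕜 := ℝ) A).continuous.measurable

theorem measurable_whitened (hXm : Measurable X) : Measurable (whitened P X) :=
  (measurable_app _).comp hXm

/-- The law of the whitened covariate. -/
def whitenedLaw (P : Measure Ω) (X : Ω → Vec d) : Measure (Vec d) := P.map (whitened P X)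

/-- With `R = Σ^{1/2}`, `E ⟪v, R⁻¹ X⟫² = ⟪R⁻¹ v, Σ R⁻¹ v⟫ = ‖R R⁻¹ v‖²`. -/
theorem whitenedLaw_isotropic (hXm : Measurable X) (hX : MemLp X 2 P)
    (hu : IsUnit (secondMoment P X).det) (v : Vec d) :
    Integrable (fun w => inner ℝ v w ^ 2) (whitenedLaw P X) ∧
      ∫ w, inner ℝ v w ^ 2 ∂whitenedLaw P X = ‖v‖ ^ 2 := by
  have hR := isInvertibleRoot_sqrtM_secondMoment hX hu
  have hm := measurable_whitened (P := P) hXm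
  have hsm : Measurable fun w : Vec d => inner ℝ v w ^ 2 := by fun_prop
  have e : ∀ ω, inner ℝ v (whitened P X ω) ^ 2 =
      inner ℝ (app (sqrtM (secondMoment P X))⁻¹ v) (X ω) *
        inner ℝ (app (sqrtM (secondMoment P X))⁻¹ v) (X ω) := fun ω => by
    rw [whitened, hR.inner_app_inv, sq]
  constructor
  · rw [whitenedLaw, integrable_map_measure hsm.aestronglyMeasurable hm.aemeasurable]
    simp only [Function.comp_def, e]
    exact integrable_inner_mul_inner hX _ _
  · rw [whitenedLaw, integral_map hm.aemeasurable hsm.aestronglyMeasurable]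
    simp only [e]
    rw [← inner_app_secondMoment hX, hR.inner_app_self, app_inv_cancel hR.isUnit_det]

theorem hasSubgaussianMGF_whitenedLaw (hXm : Measurable X) {ρ : NNReal}
    (h : SubgaussianProjections P X ρ) {u : Vec d} (hu : ‖u‖ = 1) :
    HasSubgaussianMGF (fun w => inner ℝ u w) ρ (whitenedLaw P X) := by
  have hm := measurable_whitened (P := P) hXm
  have hsm : ∀ t : ℝ, Measurable fun w : Vec d => Real.exp (t * inner ℝ u w) := fun t => by
    fun_prop
  have e : ∀ (t : ℝ) (w : Vec d), t * inner ℝ u w = inner ℝ (t • u) w := fun t w => by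
    rw [inner_smul_left, conj_trivial]
  refine ⟨fun t => ?_, fun t => ?_⟩
  · rw [whitenedLaw, integrable_map_measure (hsm t).aestronglyMeasurable hm.aemeasurable]
    simp only [Function.comp_def, e]
    exact (h.2 (t • u)).1
  · rw [mgf, whitenedLaw, integral_map hm.aemeasurable (hsm t).aestronglyMeasurable]
    simp only [e]
    refine ((h.2 (t • u)).2).trans_eq ?_
    rw [norm_smul, hu, mul_one, Real.norm_eq_abs, sq_abs]

theorem whitenedLaw_norm_sq_le (hXm : Measurable X) (hd : 0 < d) {ρ : ℝ}
    (h : BoundedLeverage P X ρ) : ∀ᵐ w ∂whitenedLaw P X, ‖w‖ ^ 2 ≤ ρ ^ 2 * d := by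
  have hd' : (0 : ℝ) < d := Nat.cast_pos.2 hd
  have hm := measurable_whitened (P := P) hXm
  rw [whitenedLaw, ae_map_iff hm.aemeasurable (measurableSet_le (by fun_prop) measurable_const)]
  filter_upwards [h.2] with ω hω
  rw [div_le_iff₀ (Real.sqrt_pos.2 hd')] at hω
  calc ‖whitened P X ω‖ ^ 2 ≤ (ρ * Real.sqrt d) ^ 2 := by gcongr
    _ = ρ ^ 2 * d := by rw [mul_pow, Real.sq_sqrt hd'.le]

/-- The noise of a correct linear model is conditionally subgaussian under the law of `(X, Y)`. -/
theorem condSubgaussian_of_model [IsProbabilityMeasure P] {Y : Ω → ℝ} (hXm : Measurable X)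
    (hYm : Measurable Y) {σ : ℝ} (hnoise : SubgaussianNoise P X Y σ)
    (hmodel : ∀ᵐ ω ∂P, bias P X Y ω = 0) :
    CondSubgaussian (P.map fun ω => (X ω, Y ω)) Prod.fst
      (fun z : Vec d × ℝ => z.2 - inner ℝ z.1 (betaStar P X Y)) (σ ^ 2) := by
  intro q f hf
  have hXY : Measurable fun ω => (X ω, Y ω) := hXm.prodMk hYm
  set β := betaStar P X Y
  set g : Ω → ℝ := fun ω => Real.exp (q * (Y ω - inner ℝ (X ω) β)) with hg
  have hgm : Measurable g := by fun_prop
  -- The correct model replaces the conditional expectation by `⟪X, β⟫`, making the noise an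
  -- explicit measurable function of `(X, Y)`.
  have hae : (fun ω => Real.exp (q * noise P X Y ω)) =ᵐ[P] g := by
    filter_upwards [hmodel] with ω hω
    have : regression P X Y ω = inner ℝ (X ω) β := by
      rw [bias] at hω
      linarith
    simp only [hg, noise, this]
  obtain ⟨hi, hle⟩ := hnoise.2 q
  have hcond : ∀ᵐ ω ∂P, (P[g | MeasurableSpace.comap X inferInstance]) ω ≤
      Real.exp (q ^ 2 * σ ^ 2 / 2) := by
    filter_upwards [hle, condExp_congr_ae (m := MeasurableSpace.comap X inferInstance) hae]
      with ω h1 h2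
    rwa [← h2]
  have h := lintegral_comp_mul_ofReal_le_of_condExp_le hXm hgm (fun ω => (Real.exp_pos _).le)
    (hi.congr hae) (Real.exp_pos _).le hcond hf
  rw [lintegral_map (by fun_prop) hXY, lintegral_map (by fun_prop) hXY]
  exact h

end Population

/-! ### From the product law to the sample, and the union of bad events -/

section Sampling

/-- The law of independent copies is a product law; outer measure version for arbitrary events. -/
theorem measure_sample_le {Ω₀ Ω α : Type*} [MeasurableSpace Ω₀] [MeasurableSpace Ω]
    [MeasurableSpace α] {P : Measure Ω₀} {μ : Measure Ω} [IsProbabilityMeasure μ] {n : ℕ}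
    {Z : Fin n → Ω → α} {Z₀ : Ω₀ → α} (hcopy : ∀ i, IdentDistrib (Z i) Z₀ μ P)
    (hindep : iIndepFun Z μ) (B : Set (Fin n → α)) :
    μ {ω | (fun i => Z i ω) ∈ B} ≤ Measure.pi (fun _ : Fin n => P.map Z₀) B := by
  have hm : ∀ i, AEMeasurable (Z i) μ := fun i => (hcopy i).aemeasurable_fst
  have h1 := (iIndepFun_iff_map_fun_eq_pi_map hm).1 hindep
  simp only [fun i => (hcopy i).map_eq] at h1
  rw [← h1]
  exact Measure.le_map_apply (aemeasurable_pi_lambda _ hm) B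

end Sampling

section Main

variable {Ω₀ Ω : Type*} [MeasurableSpace Ω₀] [MeasurableSpace Ω] {P : Measure Ω₀}
  {d : ℕ} {X : Ω₀ → Vec d} {Y : Ω₀ → ℝ} {μ : Measure Ω}
  [IsProbabilityMeasure μ] {n : ℕ} {Xs : Fin n → Ω → Vec d} {Ys : Fin n → Ω → ℝ}

/-- Whitening by the population `Σ^{-1/2}` is a fixed measurable map, so the whitened samples are
independent with law `whitenedLaw P X`. -/
theorem measure_not_designLowerBound_le
    (hcopy : ∀ i, IdentDistrib (fun ω => (Xs i ω, Ys i ω)) (fun ω => (X ω, Y ω)) μ P)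
    (hindep : iIndepFun (fun i ω => (Xs i ω, Ys i ω)) μ) {κ δ : ℝ}
    (htail : Measure.pi (fun _ : Fin n => whitenedLaw P X)
      {w | ∃ v : Vec d, ∑ i, inner ℝ v (w i) ^ 2 < n * κ * ‖v‖ ^ 2} ≤ ENNReal.ofReal δ) :
    μ {ω | ¬ DesignLowerBound (sqrtM (secondMoment P X)) (fun i => Xs i ω) κ} ≤
      ENNReal.ofReal δ := by
  set W : Vec d × ℝ → Vec d := fun z => app (sqrtM (secondMoment P X))⁻¹ z.1 with hW
  have hWm : Measurable W := (measurable_app _).comp measurable_fst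
  have h := measure_sample_le (fun i => (hcopy i).comp hWm)
    (hindep.comp (fun _ => W) fun _ => hWm)
    {w | ∃ v : Vec d, ∑ i, inner ℝ v (w i) ^ 2 < n * κ * ‖v‖ ^ 2}
  refine le_trans (measure_mono fun ω hω => ?_) (h.trans htail)
  simp only [DesignLowerBound, Set.mem_ofPred_eq, not_forall, not_le] at hω
  exact hω

/-- From a lower bound on the whitened design to the guarantees for least squares. -/
theorem ols_guarantee [IsProbabilityMeasure P] (hXm : Measurable X) (hYm : Measurable Y) (hX : MemLp X 2 P)
    (hSigma : IsUnit (secondMoment P X).det)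
    (hcopy : ∀ i, IdentDistrib (fun ω => (Xs i ω, Ys i ω)) (fun ω => (X ω, Y ω)) μ P)
    (hindep : iIndepFun (fun i ω => (Xs i ω, Ys i ω)) μ)
    {σ : ℝ} (hnoise : SubgaussianNoise P X Y σ) (hmodel : ∀ᵐ ω ∂P, bias P X Y ω = 0)
    {δ : ℝ} (hδ : δ ∈ Set.Ioo (0 : ℝ) 1) (hn : 0 < n) {κ : ℝ} (hκ : 0 < κ)
    (htail : Measure.pi (fun _ : Fin n => whitenedLaw P X)
      {w | ∃ v : Vec d, ∑ i, inner ℝ v (w i) ^ 2 < n * κ * ‖v‖ ^ 2} ≤ ENNReal.ofReal δ) :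
    1 - 2 * δ ≤ μ.real {ω |
      (empSecondMoment fun i => Xs i ω).PosDef ∧
      specNorm (sqrtM (secondMoment P X) * (empSecondMoment fun i => Xs i ω)⁻¹
          * sqrtM (secondMoment P X)) ≤ 1 / κ ∧
      mNorm (secondMoment P X)
          (ols (fun i => Xs i ω) (fun i => Ys i ω) - betaStar P X Y) ^ 2
        ≤ 1 / κ * rate d σ δ n} := by
  have hR := isInvertibleRoot_sqrtM_secondMoment hX hSigma
  have hn' : (0 : ℝ) < n := Nat.cast_pos.2 hn
  set β := betaStar P X Y with hβ
  set t : ℝ := Real.log (1 / δ) with ht_def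
  have ht : 0 ≤ t := Real.log_nonneg (by rw [one_div]; exact (one_le_inv₀ hδ.1).2 hδ.2.le)
  have hexp : Real.exp (-t) = δ := by
    rw [ht_def, one_div, Real.log_inv, neg_neg, Real.exp_log hδ.1]
  have hcs := condSubgaussian_of_model hXm hYm hnoise hmodel
  have : IsProbabilityMeasure (P.map fun ω => (X ω, Y ω)) :=
    Measure.isProbabilityMeasure_map (hXm.prodMk hYm).aemeasurable
  have hN := hcs.measure_quadratic_gt_le_exp (n := n) measurable_fst (by fun_prop) ht
  rw [hexp] at hN
  have hN' := (measure_sample_le hcopy hindep _).trans hN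
  have hD := measure_not_designLowerBound_le hcopy hindep htail
  set G : Set Ω := {ω |
      (empSecondMoment fun i => Xs i ω).PosDef ∧
      specNorm (sqrtM (secondMoment P X) * (empSecondMoment fun i => Xs i ω)⁻¹
          * sqrtM (secondMoment P X)) ≤ 1 / κ ∧
      mNorm (secondMoment P X)
          (ols (fun i => Xs i ω) (fun i => Ys i ω) - β) ^ 2
        ≤ 1 / κ * rate d σ δ n} with hG
  have hcompl : μ Gᶜ ≤ ENNReal.ofReal (2 * δ) := by
    refine (measure_mono ?_).trans ((measure_union_le _ _).trans
      ((add_le_add hD hN').trans_eq ?_))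
    · intro ω hω
      by_cases hdes : DesignLowerBound (sqrtM (secondMoment P X)) (fun i => Xs i ω) κ
      · refine Or.inr ⟨hdes.gaussMass_ne_top hR hn hκ,
          ols (fun i => Xs i ω) (fun i => Ys i ω) - β,
          fun h => normal_equations hn (hdes.posDef hR hn hκ).det_pos.ne'.isUnit _ β h, ?_⟩
        by_contra hcon
        push Not at hcon
        refine hω ⟨hdes.posDef hR hn hκ, hdes.specNorm_le hR hn hκ,
          (hdes.mNorm_sq_le hR hn hκ _).trans ?_⟩
        rw [rate]
        gcongr
      · exact Or.inl hdes
    · rw [← ENNReal.ofReal_add hδ.1.le hδ.1.le, two_mul]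
  -- Subadditivity replaces the complement formula, so measurability of `G` is not needed.
  have h1 : (1 : ENNReal) ≤ μ G + μ Gᶜ := by
    rw [← measure_univ (μ := μ), ← Set.union_compl_self G]
    exact measure_union_le _ _
  have h2 : (1 : ENNReal) ≤ ENNReal.ofReal (μ.real G + 2 * δ) := by
    rw [ENNReal.ofReal_add measureReal_nonneg (by linarith [hδ.1]), ofReal_measureReal]
    exact h1.trans (by gcongr)
  rw [ENNReal.one_le_ofReal] at h2
  linarith

end Main

/-! ### Sample size thresholds -/

section SampleSize

variable {d : ℕ} {ρ δ : ℝ} {n : ℕ}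

/-- Since `L / n < 1/(70ρ²)`, the root is at most `17/(25ρ)` because `32/70 ≤ (17/25)²`, the linear
term is at most `1/(35ρ)`, and `(10/9)(17/25 + 1/35) ≤ 4/5`. -/
theorem one_fifth_le_of_n₁_lt (hρ : 1 ≤ ρ) (hδ : δ ∈ Set.Ioo (0 : ℝ) 1) (hn : n₁ d ρ δ < n) :
    0 ≤ d * Real.log 41 + Real.log (2 / δ) ∧ 0 < n ∧
    1 / 5 ≤ 1 - 10 * ρ / 9 *
      (Real.sqrt (32 * (d * Real.log 41 + Real.log (2 / δ)) / n)
        + 2 * (d * Real.log 41 + Real.log (2 / δ)) / n) := by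
  set L : ℝ := d * Real.log 41 + Real.log (2 / δ) with hL
  have hL0 : 0 ≤ L := by
    have h1 : 0 ≤ Real.log 41 := Real.log_nonneg (by norm_num)
    have h2 : 0 ≤ Real.log (2 / δ) := Real.log_nonneg (by
      rw [le_div_iff₀ hδ.1]
      linarith [hδ.2])
    positivity
  have hn' : 70 * ρ ^ 2 * L < n := hn
  have hnpos : (0 : ℝ) < n := lt_of_le_of_lt (by positivity) hn'
  have hρ0 : 0 < ρ := by linarith
  have h1 : L / n ≤ 1 / (70 * ρ ^ 2) := by
    rw [div_le_div_iff₀ hnpos (by positivity)]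
    linarith
  have h2 : Real.sqrt (32 * L / n) ≤ 17 / (25 * ρ) := by
    refine Real.sqrt_le_iff.2 ⟨by positivity, ?_⟩
    calc 32 * L / n = 32 * (L / n) := by ring
      _ ≤ 32 * (1 / (70 * ρ ^ 2)) := by gcongr
      _ ≤ (17 / (25 * ρ)) ^ 2 := by
          rw [div_pow, mul_pow, mul_one_div, div_le_div_iff₀ (by positivity) (by positivity)]
          nlinarith [sq_nonneg ρ]
  have h3 : 2 * L / n ≤ 1 / (35 * ρ) := by
    calc 2 * L / n = 2 * (L / n) := by ring
      _ ≤ 2 * (1 / (70 * ρ ^ 2)) := by gcongr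
      _ ≤ 1 / (35 * ρ) := by
          rw [mul_one_div, div_le_div_iff₀ (by positivity) (by positivity)]
          nlinarith
  refine ⟨hL0, by exact_mod_cast hnpos, ?_⟩
  have h4 : 10 * ρ / 9 * (Real.sqrt (32 * L / n) + 2 * L / n) ≤
      10 * ρ / 9 * (17 / (25 * ρ) + 1 / (35 * ρ)) := by gcongr
  have h5 : 10 * ρ / 9 * (17 / (25 * ρ) + 1 / (35 * ρ)) ≤ 4 / 5 := by
    field_simp
    norm_num
  linarith

theorem one_fifth_le_of_n₂_lt (hρ : 1 ≤ ρ) (hδ : δ ∈ Set.Ioo (0 : ℝ) 1) (hn : n₂ d ρ δ < n) :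
    0 ≤ Real.log (d / δ) ∧ 0 < n ∧
    1 / 5 ≤ 1 - Real.sqrt (2 * ρ ^ 2 * d * Real.log (d / δ) / n) := by
  have hlog : 0 ≤ Real.log (d / δ) := by
    -- For `d = 0` the convention `Real.log 0 = 0` applies.
    rcases Nat.eq_zero_or_pos d with rfl | hd
    · simp
    · have : (1 : ℝ) ≤ d := by exact_mod_cast hd
      refine Real.log_nonneg ?_
      rw [le_div_iff₀ hδ.1]
      linarith [hδ.2]
  have hn' : 4 * ρ ^ 2 * d * Real.log (d / δ) < n := hn
  have hnpos : (0 : ℝ) < n := lt_of_le_of_lt (by positivity) hn'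
  refine ⟨hlog, by exact_mod_cast hnpos, ?_⟩
  have h2 : Real.sqrt (2 * ρ ^ 2 * d * Real.log (d / δ) / n) ≤ 4 / 5 := by
    refine Real.sqrt_le_iff.2 ⟨by norm_num, ?_⟩
    rw [div_le_iff₀ hnpos]
    linarith
  linarith

end SampleSize

end RandomDesign

end

theorem theorem1
    {Ω₀ Ω : Type*} [MeasurableSpace Ω₀] [MeasurableSpace Ω]
    -- the population pair `(X, Y)`
    (P : Measure Ω₀) [IsProbabilityMeasure P] {d : ℕ}
    (X : Ω₀ → RandomDesign.Vec d) (Y : Ω₀ → ℝ)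
    (hXm : Measurable X) (hYm : Measurable Y)
    (hX : MemLp X 2 P) (hY : Integrable Y P)
    (hSigma : IsUnit (RandomDesign.secondMoment P X).det)
    -- the sample: independent copies of `(X, Y)`
    (μ : Measure Ω) [IsProbabilityMeasure μ] {n : ℕ}
    (Xs : Fin n → Ω → RandomDesign.Vec d) (Ys : Fin n → Ω → ℝ)
    (hcopy : ∀ i, IdentDistrib (fun ω => (Xs i ω, Ys i ω)) (fun ω => (X ω, Y ω)) μ P)
    (hindep : iIndepFun (fun i ω => (Xs i ω, Ys i ω)) μ)
    -- subgaussian noise and correct model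
    (σ : ℝ) (hnoise : RandomDesign.SubgaussianNoise P X Y σ)
    (hmodel : ∀ᵐ ω ∂P, RandomDesign.bias P X Y ω = 0)
    (δ : ℝ) (hδ : δ ∈ Set.Ioo (0 : ℝ) 1) :
    (∀ ρ : ℝ, RandomDesign.SubgaussianProjections P X ρ → RandomDesign.n₁ d ρ δ < n →
      RandomDesign.K₁ d ρ δ n ≤ 5 ∧
      1 - 2 * δ ≤ μ.real {ω |
        (RandomDesign.empSecondMoment fun i => Xs i ω).PosDef ∧
        RandomDesign.specNorm
            (RandomDesign.sqrtM (RandomDesign.secondMoment P X)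
              * (RandomDesign.empSecondMoment fun i => Xs i ω)⁻¹
              * RandomDesign.sqrtM (RandomDesign.secondMoment P X))
          ≤ RandomDesign.K₁ d ρ δ n ∧
        RandomDesign.mNorm (RandomDesign.secondMoment P X)
            (RandomDesign.ols (fun i => Xs i ω) (fun i => Ys i ω)
              - RandomDesign.betaStar P X Y) ^ 2
          ≤ RandomDesign.K₁ d ρ δ n * RandomDesign.rate d σ δ n}) ∧
    (∀ ρ : ℝ, RandomDesign.BoundedLeverage P X ρ → RandomDesign.n₂ d ρ δ < n →
      RandomDesign.K₂ d ρ δ n ≤ 5 ∧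
      1 - 2 * δ ≤ μ.real {ω |
        (RandomDesign.empSecondMoment fun i => Xs i ω).PosDef ∧
        RandomDesign.specNorm
            (RandomDesign.sqrtM (RandomDesign.secondMoment P X)
              * (RandomDesign.empSecondMoment fun i => Xs i ω)⁻¹
              * RandomDesign.sqrtM (RandomDesign.secondMoment P X))
          ≤ RandomDesign.K₂ d ρ δ n ∧
        RandomDesign.mNorm (RandomDesign.secondMoment P X)
            (RandomDesign.ols (fun i => Xs i ω) (fun i => Ys i ω)
              - RandomDesign.betaStar P X Y) ^ 2
          ≤ RandomDesign.K₂ d ρ δ n * RandomDesign.rate d σ δ n}) := by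
  have hprob : IsProbabilityMeasure (RandomDesign.whitenedLaw P X) :=
    Measure.isProbabilityMeasure_map (RandomDesign.measurable_whitened hXm).aemeasurable
  have hiso := RandomDesign.whitenedLaw_isotropic hXm hX hSigma
  have hle5 : ∀ {κ : ℝ}, 1 / 5 ≤ κ → 1 / κ ≤ 5 := fun {κ} hκ => by
    rw [div_le_iff₀ (by linarith)]
    linarith
  refine ⟨fun ρ hρ hn => ?_, fun ρ hρ hn => ?_⟩
  · obtain ⟨hL, hn0, hκ⟩ := RandomDesign.one_fifth_le_of_n₁_lt hρ.1 hδ hn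
    refine ⟨hle5 hκ, RandomDesign.ols_guarantee hXm hYm hX hSigma hcopy hindep hnoise hmodel hδ hn0
      (by linarith) ?_⟩
    lift ρ to NNReal using (by linarith [hρ.1])
    have hρ0 : 0 < ρ := by
      have h1 : (1 : ℝ) ≤ ρ := hρ.1
      have h2 : (0 : ℝ) < ρ := by linarith
      exact_mod_cast h2
    -- With `s = d log 41 + log(2/δ)`, the bound `41^d · 2 exp(-s)` is exactly `δ`.
    refine (RandomDesign.measure_pi_exists_sum_sq_lt_le_of_subgaussian hρ0
      (fun u hu => RandomDesign.hasSubgaussianMGF_whitenedLaw hXm hρ hu) (fun v => (hiso v).1)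
      (fun v => (hiso v).2) hn0 hL).trans (ENNReal.ofReal_le_ofReal (le_of_eq ?_))
    rw [neg_add, Real.exp_add, Real.exp_neg (Real.log _), Real.exp_neg, Real.exp_nat_mul,
      Real.exp_log (by norm_num), Real.exp_log (div_pos two_pos hδ.1), finrank_euclideanSpace_fin]
    field_simp
  · obtain ⟨hlog, hn0, hκ⟩ := RandomDesign.one_fifth_le_of_n₂_lt hρ.1 hδ hn
    refine ⟨hle5 hκ, RandomDesign.ols_guarantee hXm hYm hX hSigma hcopy hindep hnoise hmodel hδ hn0
      (by linarith) ?_⟩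
    -- The matrix Chernoff bound needs a nontrivial space and `B > 0`; for `d = 0` the bad event is
    -- empty.
    rcases Nat.eq_zero_or_pos d with rfl | hd
    · refine le_trans (measure_mono_null (t := ∅) ?_ measure_empty).le bot_le
      rintro w ⟨v, hv⟩
      rw [Subsingleton.elim v 0] at hv
      simp at hv
    · have hd' : (0 : ℝ) < d := Nat.cast_pos.2 hd
      have hn' : (0 : ℝ) < n := Nat.cast_pos.2 hn0
      have hρ0 : 0 < ρ := by linarith [hρ.1]
      have : Nonempty (Fin d) := ⟨⟨0, hd⟩⟩
      -- With `B = ρ²d` and `t² = 2B log(d/δ)/n`, the bound `d exp(-nt²/(2B))` is exactly `δ`.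
      refine (RandomDesign.measure_pi_exists_sum_sq_lt_le (fun v => (hiso v).1)
        (fun v => (hiso v).2) (B := ρ ^ 2 * d) (by positivity) (Real.sqrt_nonneg _)
        (RandomDesign.whitenedLaw_norm_sq_le hXm hd hρ) n).trans
        (ENNReal.ofReal_le_ofReal (le_of_eq ?_))
      rw [Real.sq_sqrt (by positivity)]
      have e : (n : ℝ) * (2 * ρ ^ 2 * d * Real.log (d / δ) / n) / (2 * (ρ ^ 2 * d)) =
          Real.log (d / δ) := by field_simp
      rw [e, Real.exp_neg, Real.exp_log (div_pos hd' hδ.1), finrank_euclideanSpace_fin]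
      field_simp
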